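/- Let $D(T(2,3))$ be the positive-clasped untwisted (Whitehead) double of the right-handed trefoil $T(2,3)$. For a knot $J$ and an odd integer $n\ge 1$ let $K_n(J)$ be the boundary of the following punctured Klein bottle in $S^3$: start from the standard surface bounded by the three-stranded pretzel diagram with columns of $n$, $-n$ and $n-1$ half-twists (positive means right-handed), that is, two disks joined by three twisted bands, and tie the first band into $J$ with framing $0$. Equivalently, regarding the two disks and the middle band (the $n$ half-twists between the other two bands) as one disk, the left band is tied into $J$ and forms with it an annulus of framing $0$, and the right band forms with it an unknotted Möbius band with one left-handed half-twist. Let $J_n$ be the connected sum of $(3n-1)/4$ copies of $D(T(2,3))$ if $n\equiv 3 \pmod 4$; more generally, let $J_n$ be the connected sum of any number $m\ge 0$ of copies of $D(T(2,3))$. Then for every odd $n\ge 1$ the curve $K_n=K_n(J_n)$ is a knot, and its Alexander polynomial, which is defined up to multiplication by units $\pm t^k$ of $\mathbb Z[t,t^{-1}]$, is $$\Delta_{K_n}(t)=\left(\frac{t^n+1}{t+1}\right)^2 .$$ -/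

import Mathlib

namespace KnotDiag

/-! Oriented tangle diagrams in the plane, written as words read from bottom to top.  At each
height the diagram meets the horizontal line in finitely many strands, at positions
`0, 1, 2, …` from left to right. -/

/-- The elementary pieces of a diagram.
* `cross i o`: the strands at positions `i`, `i + 1` cross.  If `o = true`, the strand running from
  bottom left to top right is the over-strand; if `o = false`, the other one is.
* `cup i d`: a local minimum, creating two strands at positions `i`, `i + 1`; the left one is
  oriented upwards if `d = true` and downwards if `d = false`, the right one oppositely.
* `cap i`: a local maximum, joining the strands at positions `i`, `i + 1`. -/
inductive Letter where
  | cross (i : ℕ) (o : Bool)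
  | cup (i : ℕ) (d : Bool)
  | cap (i : ℕ)

/-- A diagram (or its part below some height).  Its arcs are numbered `0, …, arcs - 1`; an arc runs
from undercrossing to undercrossing, except that it is also cut at local maxima.
* `strands`: the arcs met at the top, from left to right, with their orientation
  (`true` for upwards).
* `crossings`: for every crossing `(x, l, r)` the over-arc `x` and the two under-arcs, `l` on
  the left and `r` on the right of the oriented over-arc.
* `joins`: the pairs of arcs that are joined at a local maximum.
* `writhe`: the sum of the signs of the crossings. -/
structure Diagram where
  strands : List (ℕ × Bool)
  arcs : ℕ
  crossings : List (ℕ × ℕ × ℕ)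
  joins : List (ℕ × ℕ)
  writhe : ℤ

/-- The sign of a crossing `cross i o` whose lower left and lower right strands have the
orientations `d` and `e`. -/
def crossingSign (o d e : Bool) : ℤ := if o = (d == e) then 1 else -1

/-- Put one more piece on top of a diagram; `none` if the piece does not fit. -/
def Diagram.step (D : Diagram) : Letter → Option Diagram
  | .cross i true =>
    match D.strands.drop i with
    | (a, d) :: (b, e) :: rest => some
        { strands := D.strands.take i ++ (D.arcs, e) :: (a, d) :: rest
          arcs := D.arcs + 1
          crossings := D.crossings ++ [if d then (a, D.arcs, b) else (a, b, D.arcs)]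
          joins := D.joins
          writhe := D.writhe + crossingSign true d e }
    | _ => none
  | .cross i false =>
    match D.strands.drop i with
    | (a, d) :: (b, e) :: rest => some
        { strands := D.strands.take i ++ (b, e) :: (D.arcs, d) :: rest
          arcs := D.arcs + 1
          crossings := D.crossings ++ [if e then (b, a, D.arcs) else (b, D.arcs, a)]
          joins := D.joins
          writhe := D.writhe + crossingSign false d e }
    | _ => none
  | .cup i d =>
    if i ≤ D.strands.length then some
        { strands := D.strands.take i ++ (D.arcs, d) :: (D.arcs, !d) :: D.strands.drop i
          arcs := D.arcs + 1
          crossings := D.crossings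
          joins := D.joins
          writhe := D.writhe }
    else none
  | .cap i =>
    match D.strands.drop i with
    | (a, d) :: (b, e) :: rest =>
      if d = e then none else some
        { strands := D.strands.take i ++ rest
          arcs := D.arcs
          crossings := D.crossings
          joins := D.joins ++ [(a, b)]
          writhe := D.writhe }
    | _ => none

/-- Put a word on top of a diagram. -/
def Diagram.run (D : Diagram) (w : List Letter) : Option Diagram :=
  w.foldlM Diagram.step D

/-- The empty diagram. -/
def Diagram.empty : Diagram := ⟨[], 0, [], [], 0⟩

/-- A single strand, oriented upwards. -/
def Diagram.strand : Diagram := ⟨[(0, true)], 1, [], [], 0⟩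

/-- Two arcs that follow each other on the same component. -/
def Diagram.Adjacent (D : Diagram) (a b : ℕ) : Prop :=
  (∃ x, (x, a, b) ∈ D.crossings) ∨ (a, b) ∈ D.joins

/-- `D` is a closed diagram with exactly one component. -/
def Diagram.IsKnot (D : Diagram) : Prop :=
  D.strands = [] ∧ 0 < D.arcs ∧
    ∀ a < D.arcs, ∀ b < D.arcs, Relation.EqvGen D.Adjacent a b

/-! ### The Alexander polynomial -/

open LaurentPolynomial in
/-- The row `(1 - t) x + t l - r` of a crossing with over-arc `x`, left under-arc `l` and right
under-arc `r`: the Fox derivatives of the Wirtinger relation, abelianized. -/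
noncomputable def crossingRow {N : ℕ} (c : ℕ × ℕ × ℕ) (j : Fin N) : LaurentPolynomial ℤ :=
  (if j = c.1 then 1 - T 1 else 0) + (if j = c.2.1 then T 1 else 0) - (if j = c.2.2 then 1 else 0)

/-- The row `a - b` of two arcs `a`, `b` joined at a local maximum. -/
noncomputable def joinRow {N : ℕ} (c : ℕ × ℕ) (j : Fin N) : LaurentPolynomial ℤ :=
  (if j = c.1 then 1 else 0) - (if j = c.2 then 1 else 0)

/-- The rows of the Alexander matrix. -/
noncomputable def Diagram.rows (D : Diagram) : List (Fin D.arcs → LaurentPolynomial ℤ) :=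
  D.crossings.map crossingRow ++ D.joins.map joinRow

/-- The Alexander matrix: a row for each relation, a column for each arc. -/
noncomputable def Diagram.alexanderMatrix (D : Diagram) :
    Matrix (Fin D.rows.length) (Fin D.arcs) (LaurentPolynomial ℤ) :=
  Matrix.of fun i j => D.rows.get i j

/-- The first elementary ideal (Alexander ideal): generated by the minors of the Alexander matrix
whose size is the number of arcs minus one. -/
noncomputable def Diagram.alexanderIdeal (D : Diagram) : Ideal (LaurentPolynomial ℤ) :=
  Ideal.span {x | ∃ (f : Fin (D.arcs - 1) → Fin D.rows.length) (g : Fin (D.arcs - 1) → Fin D.arcs),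
    x = (D.alexanderMatrix.submatrix f g).det}

/-- The word `w` is a diagram of a knot, and `p` is an Alexander polynomial of this knot: a greatest
common divisor of the first elementary ideal (so it is determined up to a unit `± t ^ k`). -/
def IsAlexanderPolynomial (w : List Letter) (p : LaurentPolynomial ℤ) : Prop :=
  ∃ D : Diagram, Diagram.empty.run w = some D ∧ D.IsKnot ∧
    (∀ x ∈ D.alexanderIdeal, p ∣ x) ∧
    ∀ q : LaurentPolynomial ℤ, (∀ x ∈ D.alexanderIdeal, q ∣ x) → q ∣ p

/-! ### Long knots, cables and doubles

A long knot is a word that leads from a single strand (at position `0`, oriented upwards) to a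
single strand; closing it up around the right gives the knot.  The connected sum of long knots is
the concatenation of the words. -/

/-- `k` half-twists of the strands at positions `i`, `i + 1`: right-handed for `k > 0`,
left-handed for `k < 0`. -/
def halfTwists (i : ℕ) (k : ℤ) : List Letter :=
  List.replicate k.natAbs (.cross i (decide (0 < k)))

/-- The writhe of a long knot diagram, that is, its blackboard framing. -/
def writhe (w : List Letter) : ℤ :=
  ((Diagram.strand.run w).map Diagram.writhe).getD 0

/-- Each strand is replaced by two parallel copies in the plane.  With `par = true` both are
oriented like the strand.  With `par = false` the copy on the left, seen along the
oriented strand, is oriented like it, and the other one oppositely; so in each pair the left one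
in the plane points upwards, the right one downwards. -/
def doubleLetter (par : Bool) : Letter → List Letter
  | .cross i o => [.cross (2 * i + 1) o, .cross (2 * i) o, .cross (2 * i + 2) o,
      .cross (2 * i + 1) o]
  | .cup i d => if par then [.cup (2 * i) d, .cup (2 * i + 1) d]
      else [.cup (2 * i) true, .cup (2 * i + 1) false]
  | .cap i => [.cap (2 * i + 1), .cap (2 * i)]

/-- The band along a long knot `w` with framing `0`: the two parallel copies of `w`, with full
twists that undo the writhe. -/
def zeroFramedBand (par : Bool) (w : List Letter) : List Letter :=
  w.flatMap (doubleLetter par) ++ halfTwists 0 (-2 * writhe w)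

/-- The right-handed trefoil `T(2,3)`, as a long knot. -/
def trefoil : List Letter := .cup 1 true :: halfTwists 0 3 ++ [.cap 1]

/-- The positive-clasped untwisted double of a long knot: the two oppositely oriented strands of
the band with framing `0` are closed by a clasp with two positive crossings. -/
def whiteheadDouble (w : List Letter) : List Letter :=
  .cup 1 false :: zeroFramedBand false w ++ [.cross 1 false, .cross 1 false, .cap 0]

/-- The connected sum of `m` copies of a long knot. -/
def connectedSum (m : ℕ) (w : List Letter) : List Letter := (List.replicate m w).flatten

/-- The knot `K_n(J)`, as the boundary of a punctured Klein bottle.  The surface is a disk with two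
bands.  The disk is a strip (at positions `2`, `3`) with `n` left-handed half-twists, between the
two bands.  The left band (at positions `0`, `1`) is tied into the long knot `J` with framing
`0`, and its `n` right-handed half-twists compensate those of the strip, so that the annulus that
it forms with the disk has framing `0`.  The right band (at positions `4`, `5`) has `n - 1`
half-twists, so that it forms with the disk a Möbius band with one left-handed half-twist. -/
def K (n : ℕ) (J : List Letter) : List Letter :=
  [.cup 0 true, .cup 1 true, .cup 3 false] ++
  zeroFramedBand true J ++
  halfTwists 0 n ++ halfTwists 2 (-n) ++ halfTwists 4 (n - 1) ++
  [.cap 1, .cap 1, .cap 0]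

end KnotDiag

/-! The Alexander module of a diagram is the universal target of its colourings by Alexander
quandles, so the proof determines the colourings with values in every module. A word is read from
bottom to top as a process on coloured strands (`IsTrace`). The only free choices are the colours at
the local minima, and the only equations come from the local maxima.

The companion has no effect. A colouring of two parallel copies of a long knot by a quandle is a
colouring of the long knot itself by a doubled rack (`LinRack.double`), in which kinks act
nontrivially. For any linear rack, the Whitehead double of the trefoil has exactly one colouring
extending a given bottom colour. The reason is that passing under an antiparallel band is a mere
translation, so the trefoil imposes no condition. This reflects the triviality of its Alexander
module. Only the writhe `8` survives, as eight inverse kinks (`isTrace_whiteheadDouble_trefoil`).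
The full twists that make the framing `0` are the doubles of kinks and cancel them. Hence the band
tied into `J` acts as the identity (`eq_of_isTrace_zeroFramedBand`), just as an unknotted band
would.

The remaining pretzel part leaves three generators `u`, `v`, `w`, the colours of the lowest minima.
With `q = (t ^ n + 1) / (t + 1)` the relations are `q (u - w) = 0` and `q (v - w) = κ (u - w)`
(`isTrace_pretzel`, `relations_iff`). Modulo `w` this is a triangular presentation matrix with
diagonal `q`, `q`, so the first elementary ideal is generated by `q ^ 2`. To see this for the actual
Alexander matrix, `sq_dvd_minor` uses a colouring by the module presented by the small matrix, and
`sq_mem_span_minors` uses the tautological colouring by the cokernel of the large one. -/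

namespace KnotDiag

/-! ### Linear racks and coloured words. -/

variable {V : Type*} [AddCommGroup V]

/-- A rack structure on an abelian group, with the linear operation `u ↦ T u + L x` for passing
under `x` from left to right. -/
structure LinRack (V : Type*) [AddCommGroup V] where
  T : V ≃+ V
  L : V →+ V
  -- Together these two identities say that `(u, x) ↦ T u + L x` is self-distributive. The quandle
  -- condition `L = 1 - T` is not imposed, so a kink may act nontrivially.
  L_T : ∀ x, L (T x) = T (L x)
  L_L : ∀ x, L (L x) = L x - T (L x)

namespace LinRack

/-- The colour of an under-arc on the left in the plane of an over-arc `a` with orientation `d`,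
where `b` is the colour of the under-arc on the right. -/
def under (Q : LinRack V) (a : V) (d : Bool) (b : V) : V :=
  if d then Q.T.symm (b - Q.L a) else Q.L a + Q.T b

theorem L_T_symm (Q : LinRack V) (x : V) : Q.L (Q.T.symm x) = Q.T.symm (Q.L x) := by
  apply Q.T.injective
  rw [← Q.L_T]; simp

/-- The inverse of the map `x ↦ T x + L x` that a positive kink induces. -/
def unkink (Q : LinRack V) (x : V) : V := Q.T.symm (x - Q.L x)

theorem unkink_zero (Q : LinRack V) : Q.unkink 0 = 0 := by simp [unkink]

theorem unkink_iterate_zero (Q : LinRack V) (k : ℕ) : Q.unkink^[k] 0 = 0 :=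
  Function.iterate_fixed Q.unkink_zero k

end LinRack

/-- The word `w` leads from the coloured strands `s` to the coloured strands `s'`, if the successive
local minima have the colours `cs`. -/
def IsTrace (Q : LinRack V) :
    List Letter → List (V × Bool) → List V → List (V × Bool) → Prop
  | [], s, cs, s' => s' = s ∧ cs = []
  | .cross i true :: w, s, cs, s' =>
    match s.drop i with
    | (a, d) :: (b, e) :: r => IsTrace Q w (s.take i ++ (Q.under a d b, e) :: (a, d) :: r) cs s'
    | _ => False
  | .cross i false :: w, s, cs, s' =>
    match s.drop i with
    -- Here the under-strand passes to the right, whereas `under` describes passing to the left.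
    -- Half a turn of the plane exchanges the two and reverses the over-strand, whence `!e`.
    | (a, d) :: (b, e) :: r => IsTrace Q w (s.take i ++ (b, e) :: (Q.under b (!e) a, d) :: r) cs s'
    | _ => False
  | .cup i d :: w, s, cs, s' =>
    i ≤ s.length ∧
    match cs with
    | x :: cs => IsTrace Q w (s.take i ++ (x, d) :: (x, !d) :: s.drop i) cs s'
    | [] => False
  | .cap i :: w, s, cs, s' =>
    match s.drop i with
    | (a, d) :: (b, e) :: r => d ≠ e ∧ a = b ∧ IsTrace Q w (s.take i ++ r) cs s'
    | _ => False

theorem isTrace_append (Q : LinRack V) (w₁ w₂ : List Letter) (s : List (V × Bool)) (cs : List V)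
    (s' : List (V × Bool)) : IsTrace Q (w₁ ++ w₂) s cs s' ↔
      ∃ cs₁ cs₂ s₁, cs = cs₁ ++ cs₂ ∧ IsTrace Q w₁ s cs₁ s₁ ∧ IsTrace Q w₂ s₁ cs₂ s' := by
  induction w₁ generalizing s cs with
  | nil =>
    constructor
    · intro h
      exact ⟨[], cs, s, rfl, ⟨rfl, rfl⟩, h⟩
    · rintro ⟨_, _, _, rfl, ⟨rfl, rfl⟩, h⟩
      exact h
  | cons l w ih =>
    rcases l with ⟨i, _ | _⟩ | ⟨i, d⟩ | i
    · simp only [List.cons_append, IsTrace]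
      split
      · exact ih _ _
      · simp
    · simp only [List.cons_append, IsTrace]
      split
      · exact ih _ _
      · simp
    · simp only [List.cons_append, IsTrace]
      constructor
      · rintro ⟨hi, h⟩
        rcases cs with _ | ⟨x, cs⟩
        · exact h.elim
        · obtain ⟨cs₁, cs₂, s₁, rfl, h₁, h₂⟩ := (ih _ _).1 h
          exact ⟨x :: cs₁, cs₂, s₁, rfl, ⟨hi, h₁⟩, h₂⟩
      · rintro ⟨cs₁, cs₂, s₁, rfl, ⟨hi, h₁⟩, h₂⟩
        rcases cs₁ with _ | ⟨x, cs₁⟩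
        · exact h₁.elim
        · exact ⟨hi, (ih _ _).2 ⟨cs₁, cs₂, s₁, rfl, h₁, h₂⟩⟩
    · simp only [List.cons_append, IsTrace]
      split
      · rw [ih]
        constructor
        · rintro ⟨h, h', cs₁, cs₂, s₁, rfl, h₁, h₂⟩
          exact ⟨cs₁, cs₂, s₁, rfl, ⟨h, h', h₁⟩, h₂⟩
        · rintro ⟨cs₁, cs₂, s₁, rfl, ⟨h, h', h₁⟩, h₂⟩
          exact ⟨h, h', cs₁, cs₂, s₁, rfl, h₁, h₂⟩
      · simp

/-! ### Colourings of diagrams -/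

/-- A colouring of the arcs of a diagram by a rack. -/
def Diagram.IsColoring (Q : LinRack V) (D : Diagram) (c : ℕ → V) : Prop :=
  (∀ x ∈ D.crossings, c x.2.2 = Q.L (c x.1) + Q.T (c x.2.1)) ∧ ∀ x ∈ D.joins, c x.1 = c x.2

/-- The colours of the strands at the top. -/
def Diagram.top {W : Type*} (D : Diagram) (c : ℕ → W) : List (W × Bool) :=
  D.strands.map fun p => (c p.1, p.2)

/-- All arcs that occur have numbers less than `D.arcs`. -/
structure Diagram.WellFormed (D : Diagram) : Prop where
  strands : ∀ p ∈ D.strands, p.1 < D.arcs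
  crossings : ∀ x ∈ D.crossings, x.1 < D.arcs ∧ x.2.1 < D.arcs ∧ x.2.2 < D.arcs
  joins : ∀ x ∈ D.joins, x.1 < D.arcs ∧ x.2 < D.arcs

theorem Diagram.run_cons (D : Diagram) (l : Letter) (w : List Letter) :
    D.run (l :: w) = (D.step l).bind fun D' => D'.run w := by
  simp only [Diagram.run, List.foldlM_cons]; rfl

theorem Diagram.run_append (D : Diagram) (w w' : List Letter) :
    D.run (w ++ w') = (D.run w).bind fun D' => D'.run w' := by
  simp only [Diagram.run, List.foldlM_append]; rfl

theorem eq_append_of_drop_eq {α : Type*} {l r : List α} {i : ℕ} {x y : α}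
    (h : l.drop i = x :: y :: r) : ∃ p, p.length = i ∧ l = p ++ x :: y :: r := by
  refine ⟨l.take i, ?_, by rw [← h, List.take_append_drop]⟩
  have := congrArg List.length h
  simp only [List.length_drop, List.length_cons] at this
  simp; omega

theorem Diagram.step_cross_true {D : Diagram} {p r : List (ℕ × Bool)} {a b : ℕ} {d e : Bool}
    (hs : D.strands = p ++ (a, d) :: (b, e) :: r) : D.step (.cross p.length true) =
      some ⟨p ++ (D.arcs, e) :: (a, d) :: r, D.arcs + 1,
        D.crossings ++ [if d then (a, D.arcs, b) else (a, b, D.arcs)], D.joins,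
        D.writhe + crossingSign true d e⟩ := by
  simp [Diagram.step, hs]

theorem Diagram.step_cross_false {D : Diagram} {p r : List (ℕ × Bool)} {a b : ℕ} {d e : Bool}
    (hs : D.strands = p ++ (a, d) :: (b, e) :: r) : D.step (.cross p.length false) =
      some ⟨p ++ (b, e) :: (D.arcs, d) :: r, D.arcs + 1,
        D.crossings ++ [if e then (b, a, D.arcs) else (b, D.arcs, a)], D.joins,
        D.writhe + crossingSign false d e⟩ := by
  simp [Diagram.step, hs]

theorem Diagram.step_cup {D : Diagram} {i : ℕ} (d : Bool) (hi : i ≤ D.strands.length) :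
    D.step (.cup i d) = some ⟨D.strands.take i ++ (D.arcs, d) :: (D.arcs, !d) :: D.strands.drop i,
      D.arcs + 1, D.crossings, D.joins, D.writhe⟩ := by
  simp [Diagram.step, hi]

theorem Diagram.step_cap {D : Diagram} {p r : List (ℕ × Bool)} {a b : ℕ} {d e : Bool}
    (hs : D.strands = p ++ (a, d) :: (b, e) :: r) (hde : d ≠ e) : D.step (.cap p.length) =
      some ⟨p ++ r, D.arcs, D.crossings, D.joins ++ [(a, b)], D.writhe⟩ := by
  simp [Diagram.step, hs, hde]

/-- What one step does, in terms of the list of strands around it. -/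
theorem Diagram.step_eq_some {D D' : Diagram} {l : Letter} (h : D.step l = some D') :
    (∃ p a d b e r, D.strands = p ++ (a, d) :: (b, e) :: r ∧ l = .cross p.length true ∧
      D' = ⟨p ++ (D.arcs, e) :: (a, d) :: r, D.arcs + 1,
        D.crossings ++ [if d then (a, D.arcs, b) else (a, b, D.arcs)], D.joins,
        D.writhe + crossingSign true d e⟩) ∨
    (∃ p a d b e r, D.strands = p ++ (a, d) :: (b, e) :: r ∧ l = .cross p.length false ∧
      D' = ⟨p ++ (b, e) :: (D.arcs, d) :: r, D.arcs + 1,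
        D.crossings ++ [if e then (b, a, D.arcs) else (b, D.arcs, a)], D.joins,
        D.writhe + crossingSign false d e⟩) ∨
    (∃ p d r, D.strands = p ++ r ∧ l = .cup p.length d ∧
      D' = ⟨p ++ (D.arcs, d) :: (D.arcs, !d) :: r, D.arcs + 1, D.crossings, D.joins, D.writhe⟩) ∨
    (∃ p a d b e r, D.strands = p ++ (a, d) :: (b, e) :: r ∧ l = .cap p.length ∧ d ≠ e ∧
      D' = ⟨p ++ r, D.arcs, D.crossings, D.joins ++ [(a, b)], D.writhe⟩) := by
  rcases l with ⟨i, _ | _⟩ | ⟨i, d⟩ | i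
  · right; left
    simp only [Diagram.step] at h
    split at h
    · rename_i a d b e r hd
      obtain ⟨p, rfl, hs⟩ := eq_append_of_drop_eq hd
      refine ⟨p, a, d, b, e, r, hs, rfl, ?_⟩
      rw [hs] at h
      simpa using h.symm
    · simp at h
  · left
    simp only [Diagram.step] at h
    split at h
    · rename_i a d b e r hd
      obtain ⟨p, rfl, hs⟩ := eq_append_of_drop_eq hd
      refine ⟨p, a, d, b, e, r, hs, rfl, ?_⟩
      rw [hs] at h
      simpa using h.symm
    · simp at h
  · right; right; left
    simp only [Diagram.step] at h
    split at h
    · rename_i hi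
      refine ⟨D.strands.take i, d, D.strands.drop i, by simp, by simp [hi], ?_⟩
      simpa using h.symm
    · simp at h
  · right; right; right
    simp only [Diagram.step] at h
    split at h
    · rename_i a d b e r hd
      obtain ⟨p, rfl, hs⟩ := eq_append_of_drop_eq hd
      split at h
      · simp at h
      · rename_i hde
        refine ⟨p, a, d, b, e, r, hs, rfl, hde, ?_⟩
        rw [hs] at h
        simpa using h.symm
    · simp at h

theorem Diagram.WellFormed.step {D D' : Diagram} (hD : D.WellFormed) {l : Letter}
    (h : D.step l = some D') : D'.WellFormed := by
  obtain ⟨h₁, h₂, h₃⟩ := hD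
  rcases Diagram.step_eq_some h with ⟨p, a, d, b, e, r, hs, -, rfl⟩ | ⟨p, a, d, b, e, r, hs, -, rfl⟩ |
    ⟨p, d, r, hs, -, rfl⟩ | ⟨p, a, d, b, e, r, hs, -, -, rfl⟩
  · have ha := h₁ (a, d) (by simp [hs])
    have hb := h₁ (b, e) (by simp [hs])
    rw [hs] at h₁
    constructor <;> simp only [List.mem_append, List.mem_cons, List.not_mem_nil] at h₁ ⊢ <;>
      cases d <;> grind
  · have ha := h₁ (a, d) (by simp [hs])
    have hb := h₁ (b, e) (by simp [hs])
    rw [hs] at h₁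
    constructor <;> simp only [List.mem_append, List.mem_cons, List.not_mem_nil] at h₁ ⊢ <;>
      cases e <;> grind
  · rw [hs] at h₁
    constructor <;> simp only [List.mem_append, List.mem_cons] at h₁ ⊢ <;> grind
  · have ha := h₁ (a, d) (by simp [hs])
    have hb := h₁ (b, e) (by simp [hs])
    rw [hs] at h₁
    constructor <;> simp only [List.mem_append, List.mem_cons, List.not_mem_nil] at h₁ ⊢ <;> grind

theorem Diagram.WellFormed.run {D D' : Diagram} (hD : D.WellFormed) {w : List Letter}
    (h : D.run w = some D') : D'.WellFormed := by
  induction w generalizing D with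
  | nil => cases h; exact hD
  | cons l w ih =>
    rw [Diagram.run_cons, Option.bind_eq_some_iff] at h
    obtain ⟨D₁, h₁, h⟩ := h
    exact ih (hD.step h₁) h

/-- The relations and arcs of a diagram persist when a piece is put on top. -/
theorem Diagram.step_mono {D D' : Diagram} {l : Letter} (h : D.step l = some D') :
    D.arcs ≤ D'.arcs ∧ D.crossings ⊆ D'.crossings ∧ D.joins ⊆ D'.joins := by
  rcases Diagram.step_eq_some h with ⟨p, a, d, b, e, r, hs, -, rfl⟩ | ⟨p, a, d, b, e, r, hs, -, rfl⟩ |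
    ⟨p, d, r, hs, -, rfl⟩ | ⟨p, a, d, b, e, r, hs, -, -, rfl⟩ <;> simp

theorem Diagram.run_mono {D D' : Diagram} {w : List Letter} (h : D.run w = some D') :
    D.arcs ≤ D'.arcs ∧ D.crossings ⊆ D'.crossings ∧ D.joins ⊆ D'.joins := by
  induction w generalizing D with
  | nil => cases h; simp
  | cons l w ih =>
    rw [Diagram.run_cons, Option.bind_eq_some_iff] at h
    obtain ⟨D₁, h₁, h⟩ := h
    obtain ⟨a₁, a₂, a₃⟩ := Diagram.step_mono h₁
    obtain ⟨b₁, b₂, b₃⟩ := ih h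
    exact ⟨a₁.trans b₁, fun x hx => b₂ (a₂ hx), fun x hx => b₃ (a₃ hx)⟩

/-- A colouring restricts to a trace; if the strands at the bottom and the local minima have
colour `0`, then so have all arcs. -/
theorem Diagram.IsColoring.exists_isTrace {Q : LinRack V} {D D' : Diagram} {c : ℕ → V}
    {w : List Letter} (h : D.run w = some D') (hc : D'.IsColoring Q c) :
    ∃ cs, IsTrace Q w (D.top c) cs (D'.top c) ∧
      ((∀ p ∈ D.strands, c p.1 = 0) → (∀ x ∈ cs, x = 0) →
        ∀ a, D.arcs ≤ a → a < D'.arcs → c a = 0) := by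
  induction w generalizing D with
  | nil =>
    cases h
    exact ⟨[], ⟨rfl, rfl⟩, fun _ _ a h₁ h₂ => absurd h₂ (by omega)⟩
  | cons l w ih =>
    rw [Diagram.run_cons, Option.bind_eq_some_iff] at h
    obtain ⟨D₁, h₁, h⟩ := h
    obtain ⟨cs, hcs, hz⟩ := ih h
    obtain ⟨-, hx, hj⟩ := Diagram.run_mono h
    rcases Diagram.step_eq_some h₁ with ⟨p, a, d, b, e, r, hs, rfl, rfl⟩ |
      ⟨p, a, d, b, e, r, hs, rfl, rfl⟩ | ⟨p, d, r, hs, rfl, rfl⟩ | ⟨p, a, d, b, e, r, hs, rfl, hde, rfl⟩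
    · have hrel := hc.1 (if d then (a, D.arcs, b) else (a, b, D.arcs)) (hx (by simp))
      have hnew : c D.arcs = Q.under (c a) d (c b) := by
        cases d <;> simp [LinRack.under] at hrel ⊢
        · exact hrel
        · rw [hrel]; simp
      refine ⟨cs, ?_, fun h0 hcs0 k hk₁ hk₂ => ?_⟩
      · simpa [IsTrace, Diagram.top, hs, hnew] using hcs
      · have hna : c D.arcs = 0 := by
          rw [hnew, h0 (a, d) (by simp [hs]), h0 (b, e) (by simp [hs])]
          cases d <;> simp [LinRack.under]
        rcases hk₁.eq_or_lt with rfl | hk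
        · exact hna
        · refine hz (fun q hq => ?_) hcs0 k hk hk₂
          simp only [List.mem_append, List.mem_cons] at hq
          rw [hs] at h0
          simp only [List.mem_append, List.mem_cons] at h0
          grind
    · have hrel := hc.1 (if e then (b, a, D.arcs) else (b, D.arcs, a)) (hx (by simp))
      have hnew : c D.arcs = Q.under (c b) (!e) (c a) := by
        cases e <;> simp [LinRack.under] at hrel ⊢
        · rw [hrel]; simp
        · exact hrel
      refine ⟨cs, ?_, fun h0 hcs0 k hk₁ hk₂ => ?_⟩
      · simpa [IsTrace, Diagram.top, hs, hnew] using hcs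
      · have hna : c D.arcs = 0 := by
          rw [hnew, h0 (a, d) (by simp [hs]), h0 (b, e) (by simp [hs])]
          cases e <;> simp [LinRack.under]
        rcases hk₁.eq_or_lt with rfl | hk
        · exact hna
        · refine hz (fun q hq => ?_) hcs0 k hk hk₂
          simp only [List.mem_append, List.mem_cons] at hq
          rw [hs] at h0
          simp only [List.mem_append, List.mem_cons] at h0
          grind
    · refine ⟨c D.arcs :: cs, ?_, fun h0 hcs0 k hk₁ hk₂ => ?_⟩
      · simpa [IsTrace, Diagram.top, hs] using hcs
      · have hna : c D.arcs = 0 := hcs0 _ (by simp)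
        rcases hk₁.eq_or_lt with rfl | hk
        · exact hna
        · refine hz (fun q hq => ?_) (fun x hx => hcs0 x (by simp [hx])) k hk hk₂
          simp only [List.mem_append, List.mem_cons] at hq
          rw [hs] at h0
          simp only [List.mem_append] at h0
          grind
    · have hrel := hc.2 (a, b) (hj (by simp))
      refine ⟨cs, ?_, fun h0 hcs0 k hk₁ hk₂ => hz (fun q hq => h0 q ?_) hcs0 k hk₁ hk₂⟩
      · simpa [IsTrace, Diagram.top, hs, hde, hrel] using hcs
      · simp only [List.mem_append] at hq
        rw [hs]
        simp only [List.mem_append, List.mem_cons]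
        tauto

theorem Diagram.WellFormed.top_update {W : Type*} {D : Diagram} (hD : D.WellFormed) (c : ℕ → W) (x : W)
    {p : List (ℕ × Bool)} (hp : p ⊆ D.strands) :
    (p.map fun q => (Function.update c D.arcs x q.1, q.2)) = p.map fun q => (c q.1, q.2) := by
  refine List.map_congr_left fun q hq => ?_
  rw [Function.update_of_ne (hD.strands q (hp hq)).ne]

theorem Diagram.WellFormed.isColoring_update {Q : LinRack V} {D : Diagram} (hD : D.WellFormed)
    {c : ℕ → V} (hc : D.IsColoring Q c) (x : V) :
    D.IsColoring Q (Function.update c D.arcs x) := by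
  refine ⟨fun y hy => ?_, fun y hy => ?_⟩
  · obtain ⟨h₁, h₂, h₃⟩ := hD.crossings y hy
    rw [Function.update_of_ne h₁.ne, Function.update_of_ne h₂.ne, Function.update_of_ne h₃.ne]
    exact hc.1 y hy
  · obtain ⟨h₁, h₂⟩ := hD.joins y hy
    rw [Function.update_of_ne h₁.ne, Function.update_of_ne h₂.ne]
    exact hc.2 y hy

theorem exists_of_top_eq {W : Type*} {D : Diagram} {c : ℕ → W} {i : ℕ} {a b : W} {d e : Bool}
    {r : List (W × Bool)} (h : (D.top c).drop i = (a, d) :: (b, e) :: r) :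
    ∃ p a' b' r', D.strands = p ++ (a', d) :: (b', e) :: r' ∧ p.length = i ∧ c a' = a ∧ c b' = b ∧
      r = r'.map fun q => (c q.1, q.2) := by
  rw [Diagram.top, ← List.map_drop] at h
  obtain ⟨⟨a', d'⟩, l₁, h₁, h₂, h₃⟩ := List.map_eq_cons_iff.1 h
  obtain ⟨⟨b', e'⟩, l₂, h₄, h₅, h₆⟩ := List.map_eq_cons_iff.1 h₃
  subst h₄
  simp only [Prod.mk.injEq] at h₂ h₅
  obtain ⟨rfl, rfl⟩ := h₂
  obtain ⟨rfl, rfl⟩ := h₅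
  obtain ⟨p, hp, hs⟩ := eq_append_of_drop_eq h₁
  exact ⟨p, a', b', l₂, hs, hp, rfl, rfl, h₆.symm⟩

/-- A trace extends a colouring. -/
theorem Diagram.WellFormed.exists_isColoring {Q : LinRack V} {D : Diagram} (hD : D.WellFormed)
    {c : ℕ → V} {w : List Letter} {cs : List V} {s' : List (V × Bool)} (hc : D.IsColoring Q c)
    (h : IsTrace Q w (D.top c) cs s') :
    ∃ D' c', D.run w = some D' ∧ (∀ a < D.arcs, c' a = c a) ∧ D'.IsColoring Q c' ∧
      D'.top c' = s' := by
  induction w generalizing D c cs with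
  | nil => exact ⟨D, c, rfl, fun _ _ => rfl, hc, h.1.symm⟩
  | cons l w ih =>
    suffices H : ∃ D₁ c₁ cs₁, D.step l = some D₁ ∧ (∀ a < D.arcs, c₁ a = c a) ∧ D₁.IsColoring Q c₁ ∧
        IsTrace Q w (D₁.top c₁) cs₁ s' by
      obtain ⟨D₁, c₁, cs₁, h₁, h₂, h₃, h₄⟩ := H
      obtain ⟨D', c', h₅, h₆, h₇, h₈⟩ := ih (hD.step h₁) h₃ h₄
      refine ⟨D', c', by rw [Diagram.run_cons, h₁]; exact h₅, fun a ha => ?_, h₇, h₈⟩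
      rw [h₆ a (ha.trans_le (Diagram.step_mono h₁).1), h₂ a ha]
    rcases l with ⟨i, _ | _⟩ | ⟨i, d⟩ | i
    · simp only [IsTrace] at h
      split at h
      · rename_i a d b e r hd
        obtain ⟨p, a', b', r', hs, rfl, rfl, rfl, rfl⟩ := exists_of_top_eq hd
        have ha := hD.strands (a', d) (by simp [hs])
        have hb := hD.strands (b', e) (by simp [hs])
        have hp := hD.top_update c (Q.under (c b') (!e) (c a')) (p := p) (by simp [hs])
        have hr := hD.top_update c (Q.under (c b') (!e) (c a')) (p := r') (by
          rw [hs]; intro x hx; simp [hx])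
        have hcol := hD.isColoring_update hc (Q.under (c b') (!e) (c a'))
        refine ⟨_, Function.update c D.arcs (Q.under (c b') (!e) (c a')), cs,
          Diagram.step_cross_false hs,
          fun k hk => Function.update_of_ne hk.ne _ _, ⟨?_, hcol.2⟩, ?_⟩
        · intro y hy
          rcases List.mem_append.1 hy with hy | hy
          · exact hcol.1 y hy
          · rw [List.mem_singleton] at hy
            subst hy
            cases e <;> simp [LinRack.under, ha.ne, hb.ne]
        · simpa [Diagram.top, hs, hp, hr, hb.ne] using h
      · exact h.elim
    · simp only [IsTrace] at h
      split at h
      · rename_i a d b e r hd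
        obtain ⟨p, a', b', r', hs, rfl, rfl, rfl, rfl⟩ := exists_of_top_eq hd
        have ha := hD.strands (a', d) (by simp [hs])
        have hb := hD.strands (b', e) (by simp [hs])
        have hp := hD.top_update c (Q.under (c a') d (c b')) (p := p) (by simp [hs])
        have hr := hD.top_update c (Q.under (c a') d (c b')) (p := r') (by
          rw [hs]; intro x hx; simp [hx])
        have hcol := hD.isColoring_update hc (Q.under (c a') d (c b'))
        refine ⟨_, Function.update c D.arcs (Q.under (c a') d (c b')), cs,
          Diagram.step_cross_true hs,
          fun k hk => Function.update_of_ne hk.ne _ _, ⟨?_, hcol.2⟩, ?_⟩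
        · intro y hy
          rcases List.mem_append.1 hy with hy | hy
          · exact hcol.1 y hy
          · rw [List.mem_singleton] at hy
            subst hy
            cases d <;> simp [LinRack.under, ha.ne, hb.ne]
        · simpa [Diagram.top, hs, hp, hr, ha.ne] using h
      · exact h.elim
    · obtain ⟨hi, h⟩ := h
      rcases cs with _ | ⟨x, cs⟩
      · exact h.elim
      · have hi' : i ≤ D.strands.length := by simpa [Diagram.top] using hi
        have hcol := hD.isColoring_update hc x
        have hp := hD.top_update c x (p := D.strands.take i) (List.take_subset _ _)
        have hr := hD.top_update c x (p := D.strands.drop i) (List.drop_subset _ _)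
        refine ⟨_, Function.update c D.arcs x, cs, Diagram.step_cup d hi',
          fun k hk => Function.update_of_ne hk.ne _ _, hcol, ?_⟩
        simpa [Diagram.top, hp, hr, List.map_take, List.map_drop] using h
    · simp only [IsTrace] at h
      split at h
      · rename_i a d b e r hd
        obtain ⟨p, a', b', r', hs, rfl, rfl, rfl, rfl⟩ := exists_of_top_eq hd
        obtain ⟨hde, hab, h⟩ := h
        refine ⟨_, c, cs, Diagram.step_cap hs hde,
          fun k hk => rfl, ⟨hc.1, ?_⟩, ?_⟩
        · intro y hy
          rcases List.mem_append.1 hy with hy | hy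
          · exact hc.2 y hy
          · rw [List.mem_singleton] at hy
            subst hy
            exact hab
        · simpa [Diagram.top, hs] using h
      · exact h.elim

end KnotDiag

namespace KnotDiag

variable {V : Type*} [AddCommGroup V]

/-! ### The Whitehead double of the trefoil -/

namespace LinRack

/-- The map that a positive kink induces. -/
def kink (Q : LinRack V) (x : V) : V := Q.T x + Q.L x

/-- The translation that passing under a band with antiparallel boundary induces. -/
def shift (Q : LinRack V) (x : V) : V := Q.T.symm (Q.L x)

theorem unkink_kink (Q : LinRack V) (x : V) : Q.unkink (Q.kink x) = x := by
  simp only [unkink, kink, map_add, map_sub, Q.L_T, Q.L_L, AddEquiv.symm_apply_apply]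
  abel

theorem kink_unkink (Q : LinRack V) (x : V) : Q.kink (Q.unkink x) = x := by
  simp only [unkink, kink, map_sub, Q.L_T_symm, Q.L_L, AddEquiv.symm_apply_apply,
    AddEquiv.apply_symm_apply]
  abel

theorem unkink_add (Q : LinRack V) (x y : V) : Q.unkink (x + y) = Q.unkink x + Q.unkink y := by
  simp only [unkink, map_add, map_sub]; abel

theorem unkink_sub (Q : LinRack V) (x y : V) : Q.unkink (x - y) = Q.unkink x - Q.unkink y := by
  simp only [unkink, map_sub]; abel

theorem kink_add (Q : LinRack V) (x y : V) : Q.kink (x + y) = Q.kink x + Q.kink y := by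
  simp only [kink, map_add]; abel

theorem kink_sub (Q : LinRack V) (x y : V) : Q.kink (x - y) = Q.kink x - Q.kink y := by
  simp only [kink, map_sub]; abel

/-- The axiom `L_L` says that kinks fix the image of `L`. -/
theorem unkink_shift (Q : LinRack V) (x : V) : Q.unkink (Q.shift x) = Q.shift x := by
  simp only [unkink, shift, Q.L_T_symm, Q.L_L, map_sub, AddEquiv.symm_apply_apply]
  abel

theorem kink_shift (Q : LinRack V) (x : V) : Q.kink (Q.shift x) = Q.shift x := by
  conv_lhs => rw [← Q.unkink_shift, Q.kink_unkink]

theorem shift_add (Q : LinRack V) (x y : V) : Q.shift (x + y) = Q.shift x + Q.shift y := by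
  simp [shift]

theorem shift_sub (Q : LinRack V) (x y : V) : Q.shift (x - y) = Q.shift x - Q.shift y := by
  simp [shift]

/-- A strand passing underneath does not see kinks in the over-strand. -/
theorem L_kink (Q : LinRack V) (x : V) : Q.L (Q.kink x) = Q.L x := by
  simp only [kink, map_add, Q.L_T, Q.L_L]; abel

theorem shift_kink (Q : LinRack V) (x : V) : Q.shift (Q.kink x) = Q.shift x := by
  rw [shift, L_kink, shift]

theorem shift_unkink (Q : LinRack V) (x : V) : Q.shift (Q.unkink x) = Q.shift x := by
  conv_rhs => rw [← Q.kink_unkink x, shift_kink]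

end LinRack

/-- The two boundary strands of the over-band are antiparallel, so `T` and its inverse cancel and a
strand passing under both is only translated. -/
theorem isTrace_band_cross (Q : LinRack V) (w : List Letter) (a c u v : V) (r : List (V × Bool))
    (cs : List V) (s' : List (V × Bool)) :
    IsTrace Q (.cross 1 true :: .cross 0 true :: .cross 2 true :: .cross 1 true :: w)
      ((a, true) :: (c, false) :: (u, true) :: (v, false) :: r) cs s' ↔
    IsTrace Q w ((u - Q.shift (a - c), true) :: (v - Q.shift (a - c), false) ::
      (a, true) :: (c, false) :: r) cs s' := by
  have key : ∀ x, Q.under a true (Q.under c false x) = x - Q.shift (a - c) := by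
    intro x
    simp only [LinRack.under, LinRack.shift, if_true, map_sub, map_add,
      AddEquiv.symm_apply_apply, Bool.false_eq_true, if_false]
    abel
  simp [IsTrace, key]

theorem isTrace_band_twist (Q : LinRack V) (w : List Letter) (a c : V) (r : List (V × Bool))
    (cs : List V) (s' : List (V × Bool)) :
    IsTrace Q (.cross 0 false :: .cross 0 false :: w) ((a, true) :: (c, false) :: r) cs s' ↔
    IsTrace Q w ((Q.unkink a + Q.shift (a - c), true) :: (Q.kink c + Q.shift (a - c), false) :: r)
      cs s' := by
  have h₁ : Q.under c true a = Q.unkink a + Q.shift (a - c) := by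
    simp only [LinRack.under, LinRack.shift, LinRack.unkink, if_true, map_sub]
    abel
  have h₂ : Q.under (Q.unkink a + Q.shift (a - c)) false c = Q.kink c + Q.shift (a - c) := by
    simp only [LinRack.under, LinRack.shift, LinRack.unkink, LinRack.kink, map_sub, map_add,
      Q.L_T_symm, Q.L_L, AddEquiv.symm_apply_apply, Bool.false_eq_true, if_false]
    abel
  simp [IsTrace, h₁, h₂]

/-- The three full twists come from the writhe `3` of the trefoil. Each adds the same translation
`Q.shift (a - c)`, because `shift` ignores kinks and both strands move together. The translations
from the three band crossings are thereby cancelled, and only kinks remain. -/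
theorem isTrace_band_three_twists (Q : LinRack V) (w : List Letter) (a c : V)
    (r : List (V × Bool)) (cs : List V) (s' : List (V × Bool)) :
    IsTrace Q (.cross 0 false :: .cross 0 false :: .cross 0 false :: .cross 0 false ::
      .cross 0 false :: .cross 0 false :: w)
      ((a - Q.shift (a - c) - Q.shift (a - c) - Q.shift (a - c), true) ::
        (c - Q.shift (a - c) - Q.shift (a - c) - Q.shift (a - c), false) :: r) cs s' ↔
    IsTrace Q w ((Q.unkink (Q.unkink (Q.unkink a)), true) ::
      (Q.kink (Q.kink (Q.kink c)), false) :: r) cs s' := by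
  simp only [isTrace_band_twist, Q.unkink_add, Q.unkink_sub, Q.kink_add, Q.kink_sub, Q.unkink_shift,
    Q.kink_shift, Q.shift_add, Q.shift_sub, Q.shift_kink, Q.shift_unkink]
  abel_nf

/-- Every band crossing translates both strands of the lower band equally, so the caps force `u - v
= a - c`. Then `u` and `v` are determined and no condition on `a`, `c` is left. -/
theorem isTrace_trefoil_band (Q : LinRack V) (w : List Letter) (a c u v : V)
    (r : List (V × Bool)) (cs : List V) (s' : List (V × Bool)) :
    IsTrace Q (.cross 1 true :: .cross 0 true :: .cross 2 true :: .cross 1 true ::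
      .cross 1 true :: .cross 0 true :: .cross 2 true :: .cross 1 true ::
      .cross 1 true :: .cross 0 true :: .cross 2 true :: .cross 1 true :: .cap 3 :: .cap 2 :: w)
      ((a, true) :: (c, false) :: (u, true) :: (v, false) :: (v, true) :: (u, false) :: r) cs s' ↔
    u = a - Q.shift (a - c) ∧ v = c - Q.shift (a - c) ∧
    IsTrace Q w ((a - Q.shift (a - c) - Q.shift (a - c) - Q.shift (a - c), true) ::
        (c - Q.shift (a - c) - Q.shift (a - c) - Q.shift (a - c), false) :: r) cs s' := by
  simp only [isTrace_band_cross, sub_sub_sub_cancel_right]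
  simp only [IsTrace, List.drop, List.take, ne_eq, Bool.false_eq_true, not_false_eq_true, true_and,
    List.nil_append, List.cons_append, Bool.true_eq_false]
  constructor
  · rintro ⟨h₁, h₂, h⟩
    have h₃ : u - v = a - c := by
      rw [← sub_sub_sub_cancel_right a c (Q.shift (u - v)), h₁, h₂]
    rw [h₃] at h₁ h₂
    subst h₁ h₂
    exact ⟨rfl, rfl, h⟩
  · rintro ⟨h₁, h₂, h⟩
    have h₃ : u - v = a - c := by rw [h₁, h₂]; abel
    rw [h₃]
    subst h₁ h₂
    exact ⟨rfl, rfl, h⟩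

/-- When `b` and `c` differ only by kinks, as they do in the double, passing under one or under the
other has the same effect, and each clasp crossing acts like a kink. -/
theorem isTrace_clasp (Q : LinRack V) (a b c : V) (hb : Q.L b = Q.L c) (cs : List V)
    (s' : List (V × Bool)) :
    IsTrace Q [.cross 1 false, .cross 1 false, .cap 0] [(a, true), (b, false), (c, true)] cs s' ↔
    a = Q.kink b ∧ s' = [(Q.unkink c, true)] ∧ cs = [] := by
  have h₁ : Q.under c false b = Q.kink b := by
    simp only [LinRack.under, LinRack.kink, hb, Bool.false_eq_true, if_false]
    abel
  have h₂ : Q.under (Q.kink b) true c = Q.unkink c := by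
    simp [LinRack.under, LinRack.unkink, Q.L_kink, hb]
  simp [IsTrace, h₁, h₂]

theorem whiteheadDouble_trefoil : whiteheadDouble trefoil =
    [.cup 1 false, .cup 2 true, .cup 3 false,
     .cross 1 true, .cross 0 true, .cross 2 true, .cross 1 true,
     .cross 1 true, .cross 0 true, .cross 2 true, .cross 1 true,
     .cross 1 true, .cross 0 true, .cross 2 true, .cross 1 true,
     .cap 3, .cap 2,
     .cross 0 false, .cross 0 false, .cross 0 false, .cross 0 false, .cross 0 false, .cross 0 false,
     .cross 1 false, .cross 1 false, .cap 0] := rfl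

/-- The twists give `unkink^3 a` and `kink^3 c`, and the clasp equates `unkink^3 a` with `kink^4 c`.
So `c = unkink^7 a`, and the outgoing strand is `unkink c`. The exponent `8` is the writhe: six
crossings from the twists and two from the clasp, while the band crossings cancel. -/
theorem isTrace_whiteheadDouble_trefoil (Q : LinRack V) (a : V) (cs : List V)
    (s' : List (V × Bool)) : IsTrace Q (whiteheadDouble trefoil) [(a, true)] cs s' ↔
      s' = [(Q.unkink^[8] a, true)] ∧
      cs = [Q.unkink^[7] a, a - Q.shift (a - Q.unkink^[7] a),
        Q.unkink^[7] a - Q.shift (a - Q.unkink^[7] a)] := by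
  rw [whiteheadDouble_trefoil]
  rcases cs with _ | ⟨c, _ | ⟨u, _ | ⟨v, r⟩⟩⟩
  · simp [IsTrace]
  · simp [IsTrace]
  · simp [IsTrace]
  · have hcup : ∀ w, IsTrace Q (.cup 1 false :: .cup 2 true :: .cup 3 false :: w) [(a, true)]
        (c :: u :: v :: r) s' ↔ IsTrace Q w
        [(a, true), (c, false), (u, true), (v, false), (v, true), (u, false), (c, true)] r s' := by
      intro w
      simp [IsTrace]
    have hc : Q.unkink (Q.unkink (Q.unkink a)) = Q.kink (Q.kink (Q.kink (Q.kink c))) ↔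
        c = Q.unkink^[7] a := by
      simp only [Function.iterate_succ', Function.iterate_zero, Function.comp_apply, id]
      constructor
      · intro h
        simp only [h, Q.unkink_kink]
      · rintro rfl
        simp only [Q.kink_unkink]
    rw [hcup, isTrace_trefoil_band, isTrace_band_three_twists,
      isTrace_clasp _ _ _ _ (by simp only [Q.L_kink]), hc, Function.iterate_succ_apply' _ 7]
    simp only [List.cons.injEq]
    constructor
    · rintro ⟨rfl, rfl, rfl, rfl, rfl⟩
      simp only [and_self]
    · rintro ⟨rfl, rfl, rfl, rfl, rfl⟩
      simp only [and_self]

/-- The colours of the local minima of the connected sum of `m` doubled trefoils. -/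
def minima (Q : LinRack V) : ℕ → V → List V
  | 0, _ => []
  | m + 1, a => [Q.unkink^[7] a, a - Q.shift (a - Q.unkink^[7] a),
      Q.unkink^[7] a - Q.shift (a - Q.unkink^[7] a)] ++ minima Q m (Q.unkink^[8] a)

theorem minima_zero (Q : LinRack V) (m : ℕ) : ∀ x ∈ minima Q m 0, x = 0 := by
  induction m with
  | zero => simp [minima]
  | succ m ih =>
    have h : Q.shift 0 = 0 := by simp [LinRack.shift]
    simpa only [minima, Q.unkink_iterate_zero, sub_zero, h, List.cons_append, List.nil_append,
      List.mem_cons, forall_eq_or_imp, true_and] using ih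

theorem connectedSum_succ (m : ℕ) (w : List Letter) :
    connectedSum (m + 1) w = w ++ connectedSum m w := by
  simp [connectedSum, List.replicate_succ]

theorem isTrace_connectedSum (Q : LinRack V) (m : ℕ) (a : V) (cs : List V)
    (s' : List (V × Bool)) :
    IsTrace Q (connectedSum m (whiteheadDouble trefoil)) [(a, true)] cs s' ↔
      s' = [(Q.unkink^[8 * m] a, true)] ∧ cs = minima Q m a := by
  induction m generalizing a cs with
  | zero => simp [connectedSum, IsTrace, minima]
  | succ m ih =>
    rw [connectedSum_succ, isTrace_append, show 8 * (m + 1) = 8 * m + 8 by ring,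
      Function.iterate_add_apply]
    simp only [isTrace_whiteheadDouble_trefoil, minima]
    constructor
    · rintro ⟨_, _, _, rfl, ⟨rfl, rfl⟩, h⟩
      obtain ⟨rfl, rfl⟩ := (ih _ _).1 h
      exact ⟨rfl, rfl⟩
    · rintro ⟨rfl, rfl⟩
      exact ⟨_, _, _, rfl, ⟨rfl, rfl⟩, (ih _ _).2 ⟨rfl, rfl⟩⟩

/-! ### Writhe and orientations -/

theorem run_whiteheadDouble_trefoil (D : Diagram) (a : ℕ) (h : D.strands = [(a, true)]) :
    ∃ D' b, D.run (whiteheadDouble trefoil) = some D' ∧ D'.strands = [(b, true)] ∧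
      D'.writhe = D.writhe + 8 := by
  obtain ⟨s, N, X, Y, k⟩ := D
  subst h
  refine ⟨_, _, rfl, rfl, ?_⟩
  simp [crossingSign]
  ring

theorem writhe_connectedSum (m : ℕ) :
    writhe (connectedSum m (whiteheadDouble trefoil)) = 8 * m := by
  have : ∀ (m : ℕ) (D : Diagram) (a : ℕ), D.strands = [(a, true)] →
      ∃ D', D.run (connectedSum m (whiteheadDouble trefoil)) = some D' ∧
        D'.writhe = D.writhe + 8 * m := by
    intro m
    induction m with
    | zero => exact fun D a h => ⟨D, rfl, by simp⟩
    | succ m ih =>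
      intro D a h
      obtain ⟨D₁, b, h₁, h₂, h₃⟩ := run_whiteheadDouble_trefoil D a h
      obtain ⟨D₂, h₄, h₅⟩ := ih D₁ b h₂
      refine ⟨D₂, ?_, ?_⟩
      · rw [connectedSum_succ, Diagram.run_append, h₁]; exact h₄
      · rw [h₅, h₃]; push_cast; ring
  obtain ⟨D, h₁, h₂⟩ := this m Diagram.strand 0 rfl
  rw [writhe, h₁, Option.map_some, Option.getD_some, h₂]
  simp [Diagram.strand]

/-- The word `w` can be put on top of strands with the given orientations. -/
def Fits : List Letter → List Bool → Prop
  | [], _ => True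
  | .cross i _ :: w, s =>
    match s.drop i with
    | d :: e :: r => Fits w (s.take i ++ e :: d :: r)
    | _ => False
  | .cup i d :: w, s => i ≤ s.length ∧ Fits w (s.take i ++ d :: (!d) :: s.drop i)
  | .cap i :: w, s =>
    match s.drop i with
    | d :: e :: r => d ≠ e ∧ Fits w (s.take i ++ r)
    | _ => False

/-- This lets a trace of the parallel double be grouped into pairs of strands, as
`exists_isTrace_of_double` requires. -/
theorem fits_connectedSum (m : ℕ) :
    Fits (connectedSum m (whiteheadDouble trefoil)) [true] := by
  induction m with
  | zero => trivial
  | succ m ih =>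
    rw [connectedSum_succ]
    generalize connectedSum m (whiteheadDouble trefoil) = w at ih
    rw [whiteheadDouble_trefoil]
    simpa [Fits] using ih

/-! ### Parallel doubles -/

/-- The rack by which a diagram is coloured if its parallel double is coloured by `Q`: a strand has
the colours of the copy on its left and of the copy on its right. -/
def LinRack.double (Q : LinRack V) : LinRack (V × V) where
  -- A strand going from left to right passes under the left copy and then under the right one: `T
  -- (T u + L x₁) + L x₂`.
  T :=
    { toFun := fun p => (Q.T (Q.T p.1), Q.T (Q.T p.2))
      invFun := fun p => (Q.T.symm (Q.T.symm p.1), Q.T.symm (Q.T.symm p.2))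
      left_inv := fun p => by simp
      right_inv := fun p => by simp
      map_add' := fun p q => by simp }
  L :=
    { toFun := fun p => (Q.T (Q.L p.1) + Q.L p.2, Q.T (Q.L p.1) + Q.L p.2)
      map_zero' := by simp
      map_add' := fun p q => by
        simp only [Prod.fst_add, Prod.snd_add, map_add, Prod.mk_add_mk]
        congr 1 <;> abel }
  L_T := fun p => by simp [Q.L_T]
  L_L := fun p => by
    ext <;> simp [Q.L_T, Q.L_L] <;> abel

theorem LinRack.double_under_true (Q : LinRack V) (a b : V × V) : Q.double.under a true b =
    (Q.under a.1 true (Q.under a.2 true b.1), Q.under a.1 true (Q.under a.2 true b.2)) := by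
  ext <;> simp [under, double, sub_sub, add_comm]

theorem LinRack.double_under_false (Q : LinRack V) (a b : V × V) : Q.double.under a false b =
    (Q.under a.2 false (Q.under a.1 false b.1), Q.under a.2 false (Q.under a.1 false b.2)) := by
  ext <;> simp [under, double] <;> abel

/-- The strands of the parallel double. -/
def flat {W : Type*} (s : List ((W × W) × Bool)) : List (W × Bool) :=
  -- The copy on the left along a downward strand lies on the right in the plane.
  s.flatMap fun p => if p.2 then [(p.1.1, true), (p.1.2, true)] else [(p.1.2, false), (p.1.1, false)]

theorem flat_append {W : Type*} (s s' : List ((W × W) × Bool)) : flat (s ++ s') = flat s ++ flat s' := by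
  simp [flat]

theorem flat_cons {W : Type*} (x : (W × W) × Bool) (s : List ((W × W) × Bool)) :
    flat (x :: s) = flat [x] ++ flat s := by
  simp [flat]

theorem length_flat {W : Type*} (s : List ((W × W) × Bool)) : (flat s).length = 2 * s.length := by
  induction s with
  | nil => rfl
  | cons x s ih =>
    rw [flat_cons, List.length_append, ih]
    rcases x with ⟨x, _ | _⟩ <;> simp [flat] <;> ring

theorem isTrace_cross_true_append (Q : LinRack V) (w : List Letter) {i : ℕ} (j : ℕ)
    (p s : List (V × Bool)) (cs : List V) (s' : List (V × Bool)) (hi : i = p.length + j) :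
    IsTrace Q (.cross i true :: w) (p ++ s) cs s' ↔
      match s.drop j with
      | (a, d) :: (b, e) :: r =>
        IsTrace Q w (p ++ (s.take j ++ (Q.under a d b, e) :: (a, d) :: r)) cs s'
      | _ => False := by
  subst hi
  simp only [IsTrace, List.drop_length_add_append, List.take_length_add_append, List.append_assoc]

theorem isTrace_cross_false_append (Q : LinRack V) (w : List Letter) {i : ℕ} (j : ℕ)
    (p s : List (V × Bool)) (cs : List V) (s' : List (V × Bool)) (hi : i = p.length + j) :
    IsTrace Q (.cross i false :: w) (p ++ s) cs s' ↔
      match s.drop j with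
      | (a, d) :: (b, e) :: r =>
        IsTrace Q w (p ++ (s.take j ++ (b, e) :: (Q.under b (!e) a, d) :: r)) cs s'
      | _ => False := by
  subst hi
  simp only [IsTrace, List.drop_length_add_append, List.take_length_add_append, List.append_assoc]

theorem isTrace_cap_append (Q : LinRack V) (w : List Letter) {i : ℕ} (j : ℕ)
    (p s : List (V × Bool)) (cs : List V) (s' : List (V × Bool)) (hi : i = p.length + j) :
    IsTrace Q (.cap i :: w) (p ++ s) cs s' ↔
      match s.drop j with
      | (a, d) :: (b, e) :: r => d ≠ e ∧ a = b ∧ IsTrace Q w (p ++ (s.take j ++ r)) cs s'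
      | _ => False := by
  subst hi
  simp only [IsTrace, List.drop_length_add_append, List.take_length_add_append, List.append_assoc]

theorem isTrace_cup_append (Q : LinRack V) (w : List Letter) {i : ℕ} (j : ℕ) (d : Bool)
    (p s : List (V × Bool)) (x : V) (cs : List V) (s' : List (V × Bool)) (hi : i = p.length + j)
    (hj : j ≤ s.length) : IsTrace Q (.cup i d :: w) (p ++ s) (x :: cs) s' ↔
      IsTrace Q w (p ++ (s.take j ++ (x, d) :: (x, !d) :: s.drop j)) cs s' := by
  subst hi
  simp only [IsTrace, List.drop_length_add_append, List.take_length_add_append, List.append_assoc,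
    List.length_append, add_le_add_iff_left, hj, true_and]

theorem isTrace_double_cross_true (Q : LinRack V) (w : List Letter) (p r : List (V × Bool))
    (a b : V × V) (d e : Bool) (cs : List V) (s' : List (V × Bool)) (i : ℕ)
    (hi : p.length = 2 * i) :
    IsTrace Q (doubleLetter true (.cross i true) ++ w)
      (p ++ (flat [(a, d), (b, e)] ++ r)) cs s' ↔
    IsTrace Q w (p ++ (flat [(Q.double.under a d b, e), (a, d)] ++ r)) cs s' := by
  -- With colours named by their position in the plane, one computation serves all orientations.
  have h : ∀ x₁ x₂ y₁ y₂ : V, IsTrace Q (doubleLetter true (.cross i true) ++ w)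
      (p ++ (x₁, d) :: (x₂, d) :: (y₁, e) :: (y₂, e) :: r) cs s' ↔
      IsTrace Q w (p ++ (Q.under x₁ d (Q.under x₂ d y₁), e) ::
        (Q.under x₁ d (Q.under x₂ d y₂), e) :: (x₁, d) :: (x₂, d) :: r) cs s' := by
    intro x₁ x₂ y₁ y₂
    simp only [doubleLetter, List.cons_append, List.nil_append]
    rw [isTrace_cross_true_append _ _ 1 _ _ _ _ (by omega)]
    simp only [List.drop, List.take, List.cons_append, List.nil_append]
    rw [isTrace_cross_true_append _ _ 0 _ _ _ _ (by omega)]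
    simp only [List.drop, List.take, List.nil_append]
    rw [isTrace_cross_true_append _ _ 2 _ _ _ _ (by omega)]
    simp only [List.drop, List.take, List.cons_append, List.nil_append]
    rw [isTrace_cross_true_append _ _ 1 _ _ _ _ (by omega)]
    simp only [List.drop, List.take, List.cons_append, List.nil_append]
  cases d <;> cases e <;>
    simpa [flat, LinRack.double_under_true, LinRack.double_under_false] using h _ _ _ _

theorem isTrace_double_cross_false (Q : LinRack V) (w : List Letter) (p r : List (V × Bool))
    (a b : V × V) (d e : Bool) (cs : List V) (s' : List (V × Bool)) (i : ℕ)
    (hi : p.length = 2 * i) :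
    IsTrace Q (doubleLetter true (.cross i false) ++ w)
      (p ++ (flat [(a, d), (b, e)] ++ r)) cs s' ↔
    IsTrace Q w (p ++ (flat [(b, e), (Q.double.under b (!e) a, d)] ++ r)) cs s' := by
  have h : ∀ x₁ x₂ y₁ y₂ : V, IsTrace Q (doubleLetter true (.cross i false) ++ w)
      (p ++ (x₁, d) :: (x₂, d) :: (y₁, e) :: (y₂, e) :: r) cs s' ↔
      IsTrace Q w (p ++ (y₁, e) :: (y₂, e) :: (Q.under y₂ (!e) (Q.under y₁ (!e) x₁), d) ::
        (Q.under y₂ (!e) (Q.under y₁ (!e) x₂), d) :: r) cs s' := by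
    intro x₁ x₂ y₁ y₂
    simp only [doubleLetter, List.cons_append, List.nil_append]
    rw [isTrace_cross_false_append _ _ 1 _ _ _ _ (by omega)]
    simp only [List.drop, List.take, List.cons_append, List.nil_append]
    rw [isTrace_cross_false_append _ _ 0 _ _ _ _ (by omega)]
    simp only [List.drop, List.take, List.nil_append]
    rw [isTrace_cross_false_append _ _ 2 _ _ _ _ (by omega)]
    simp only [List.drop, List.take, List.cons_append, List.nil_append]
    rw [isTrace_cross_false_append _ _ 1 _ _ _ _ (by omega)]
    simp only [List.drop, List.take, List.cons_append, List.nil_append]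
  cases d <;> cases e <;>
    simpa [flat, LinRack.double_under_true, LinRack.double_under_false] using h _ _ _ _

theorem isTrace_double_cup (Q : LinRack V) (w : List Letter) (p r : List (V × Bool))
    (d : Bool) (x y : V) (cs : List V) (s' : List (V × Bool)) (i : ℕ) (hi : p.length = 2 * i) :
    IsTrace Q (doubleLetter true (.cup i d) ++ w) (p ++ r) (x :: y :: cs) s' ↔
    IsTrace Q w (p ++ (flat [(if d then (x, y) else (y, x), d), (if d then (x, y) else (y, x), !d)] ++
      r)) cs s' := by
  simp only [doubleLetter, if_true, List.cons_append, List.nil_append]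
  rw [isTrace_cup_append _ _ 0 _ _ _ _ _ _ (by omega) (by simp)]
  rw [isTrace_cup_append _ _ 1 _ _ _ _ _ _ (by omega) (by simp)]
  cases d <;> simp [flat]

theorem isTrace_double_cap (Q : LinRack V) (w : List Letter) (p r : List (V × Bool))
    (a b : V × V) (d e : Bool) (hde : d ≠ e) (cs : List V) (s' : List (V × Bool)) (i : ℕ)
    (hi : p.length = 2 * i) :
    IsTrace Q (doubleLetter true (.cap i) ++ w) (p ++ (flat [(a, d), (b, e)] ++ r)) cs s' ↔
    a = b ∧ IsTrace Q w (p ++ r) cs s' := by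
  have h : ∀ x₁ x₂ y₁ y₂ : V, IsTrace Q (doubleLetter true (.cap i) ++ w)
      (p ++ (x₁, d) :: (x₂, d) :: (y₁, e) :: (y₂, e) :: r) cs s' ↔
      x₂ = y₁ ∧ x₁ = y₂ ∧ IsTrace Q w (p ++ r) cs s' := by
    intro x₁ x₂ y₁ y₂
    simp only [doubleLetter, List.cons_append, List.nil_append]
    rw [isTrace_cap_append _ _ 1 _ _ _ _ (by omega)]
    simp only [List.drop, List.take, List.cons_append, List.nil_append]
    rw [isTrace_cap_append _ _ 0 _ _ _ _ (by omega)]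
    simp only [List.drop, List.take, List.nil_append]
    tauto
  cases d <;> cases e <;> simp [flat, Prod.ext_iff] at hde h ⊢ <;> rw [h] <;> tauto

theorem exists_of_map_snd_drop {α : Type*} {s : List (α × Bool)} {i : ℕ} {d e : Bool}
    {r : List Bool} (h : (s.map Prod.snd).drop i = d :: e :: r) :
    ∃ p a b r', s = p ++ (a, d) :: (b, e) :: r' ∧ p.length = i ∧ r = r'.map Prod.snd := by
  rw [← List.map_drop] at h
  obtain ⟨⟨a, d'⟩, l₁, h₁, h₂, h₃⟩ := List.map_eq_cons_iff.1 h
  obtain ⟨⟨b, e'⟩, l₂, h₄, h₅, h₆⟩ := List.map_eq_cons_iff.1 h₃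
  subst h₄ h₂ h₅
  obtain ⟨p, hp, hs⟩ := eq_append_of_drop_eq h₁
  exact ⟨p, a, b, l₂, hs, hp, h₆.symm⟩

/-- A trace of the parallel double comes from a trace in the doubled rack. -/
theorem exists_isTrace_of_double (Q : LinRack V) (w : List Letter) (s : List ((V × V) × Bool))
    (r : List (V × Bool)) (cs : List V) (s' : List (V × Bool)) (hw : Fits w (s.map Prod.snd))
    (h : IsTrace Q (w.flatMap (doubleLetter true)) (flat s ++ r) cs s') :
    ∃ cs₂ s₂, IsTrace Q.double w s cs₂ s₂ ∧ s' = flat s₂ ++ r ∧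
      ((∀ x ∈ cs₂, x = 0) → ∀ x ∈ cs, x = 0) := by
  induction w generalizing s cs with
  | nil =>
    obtain ⟨rfl, rfl⟩ := h
    exact ⟨[], s, ⟨rfl, rfl⟩, rfl, by simp⟩
  | cons l w ih =>
    rw [List.flatMap_cons] at h
    rcases l with ⟨i, _ | _⟩ | ⟨i, d⟩ | i
    · simp only [Fits] at hw
      split at hw
      · rename_i d e r' hd
        obtain ⟨p, a, b, r', rfl, rfl, rfl⟩ := exists_of_map_snd_drop hd
        rw [flat_append, flat_cons, flat_cons (b, e), ← List.append_assoc (flat [(a, d)]),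
          ← flat_append, List.append_assoc, List.append_assoc] at h
        rw [List.singleton_append, isTrace_double_cross_false _ _ _ _ _ _ _ _ _ _ _ (length_flat p),
          ← List.append_assoc, ← flat_append, ← List.append_assoc, ← flat_append] at h
        obtain ⟨cs₂, s₂, h₁, h₂, h₃⟩ := ih _ _ (by simpa using hw) h
        exact ⟨cs₂, s₂, by simpa [IsTrace] using h₁, h₂, h₃⟩
      · exact hw.elim
    · simp only [Fits] at hw
      split at hw
      · rename_i d e r' hd
        obtain ⟨p, a, b, r', rfl, rfl, rfl⟩ := exists_of_map_snd_drop hd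
        rw [flat_append, flat_cons, flat_cons (b, e), ← List.append_assoc (flat [(a, d)]),
          ← flat_append, List.append_assoc, List.append_assoc] at h
        rw [List.singleton_append, isTrace_double_cross_true _ _ _ _ _ _ _ _ _ _ _ (length_flat p),
          ← List.append_assoc, ← flat_append, ← List.append_assoc, ← flat_append] at h
        obtain ⟨cs₂, s₂, h₁, h₂, h₃⟩ := ih _ _ (by simpa using hw) h
        exact ⟨cs₂, s₂, by simpa [IsTrace] using h₁, h₂, h₃⟩
      · exact hw.elim
    · obtain ⟨hi, hw⟩ := hw
      rcases cs with _ | ⟨x, _ | ⟨y, cs⟩⟩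
      · simp [doubleLetter, IsTrace] at h
      · simp [doubleLetter, IsTrace] at h
      · rw [List.length_map] at hi
        have hp : (flat (s.take i)).length = 2 * i := by simp [length_flat, hi]
        rw [← List.take_append_drop i s, flat_append, List.append_assoc,
          isTrace_double_cup _ _ _ _ _ _ _ _ _ _ hp, ← List.append_assoc, ← flat_append,
          ← List.append_assoc, ← flat_append] at h
        obtain ⟨cs₂, s₂, h₁, h₂, h₃⟩ := ih _ _ (by simpa using hw) h
        refine ⟨(if d then (x, y) else (y, x)) :: cs₂, s₂, ⟨hi, by simpa using h₁⟩, h₂, ?_⟩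
        intro h0
        have hxy := h0 _ List.mem_cons_self
        have hcs := h₃ fun z hz => h0 z (List.mem_cons_of_mem _ hz)
        cases d <;> simp at hxy <;> simp [hxy] <;> exact hcs
    · simp only [Fits] at hw
      split at hw
      · rename_i d e r' hd
        obtain ⟨hde, hw⟩ := hw
        obtain ⟨p, a, b, r', rfl, rfl, rfl⟩ := exists_of_map_snd_drop hd
        rw [flat_append, flat_cons, flat_cons (b, e), ← List.append_assoc (flat [(a, d)]),
          ← flat_append, List.append_assoc, List.append_assoc] at h
        rw [List.singleton_append, isTrace_double_cap _ _ _ _ _ _ _ _ hde _ _ _ (length_flat p),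
          ← List.append_assoc, ← flat_append] at h
        obtain ⟨hab, h⟩ := h
        obtain ⟨cs₂, s₂, h₁, h₂, h₃⟩ := ih _ _ (by simpa using hw) h
        exact ⟨cs₂, s₂, by simpa [IsTrace, hde, hab] using h₁, h₂, h₃⟩
      · exact hw.elim

/-- A trace in the doubled rack gives a trace of the parallel double. -/
theorem exists_isTrace_double (Q : LinRack V) (w : List Letter) (s : List ((V × V) × Bool))
    (r : List (V × Bool)) (cs₂ : List (V × V)) (s₂ : List ((V × V) × Bool))
    (h : IsTrace Q.double w s cs₂ s₂) :
    ∃ cs, IsTrace Q (w.flatMap (doubleLetter true)) (flat s ++ r) cs (flat s₂ ++ r) := by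
  induction w generalizing s cs₂ with
  | nil =>
    obtain ⟨rfl, rfl⟩ := h
    exact ⟨[], rfl, rfl⟩
  | cons l w ih =>
    rw [List.flatMap_cons]
    rcases l with ⟨i, _ | _⟩ | ⟨i, d⟩ | i
    · simp only [IsTrace] at h
      split at h
      · rename_i a d b e r' hd
        obtain ⟨p, rfl, rfl⟩ := eq_append_of_drop_eq hd
        obtain ⟨cs, hcs⟩ := ih _ _ h
        refine ⟨cs, ?_⟩
        rw [flat_append, flat_cons, flat_cons (b, e), ← List.append_assoc (flat [(a, d)]),
          ← flat_append, List.append_assoc, List.append_assoc]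
        rw [List.singleton_append, isTrace_double_cross_false _ _ _ _ _ _ _ _ _ _ _ (length_flat p),
          ← List.append_assoc, ← flat_append, ← List.append_assoc, ← flat_append]
        simpa using hcs
      · exact h.elim
    · simp only [IsTrace] at h
      split at h
      · rename_i a d b e r' hd
        obtain ⟨p, rfl, rfl⟩ := eq_append_of_drop_eq hd
        obtain ⟨cs, hcs⟩ := ih _ _ h
        refine ⟨cs, ?_⟩
        rw [flat_append, flat_cons, flat_cons (b, e), ← List.append_assoc (flat [(a, d)]),
          ← flat_append, List.append_assoc, List.append_assoc]
        rw [List.singleton_append, isTrace_double_cross_true _ _ _ _ _ _ _ _ _ _ _ (length_flat p),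
          ← List.append_assoc, ← flat_append, ← List.append_assoc, ← flat_append]
        simpa using hcs
      · exact h.elim
    · obtain ⟨hi, h⟩ := h
      rcases cs₂ with _ | ⟨⟨x, y⟩, cs₂⟩
      · exact h.elim
      · obtain ⟨cs, hcs⟩ := ih _ _ h
        have hp : (flat (s.take i)).length = 2 * i := by simp [length_flat, hi]
        have hxy : (if d then (if d then (x, y) else (y, x))
          else ((if d then (x, y) else (y, x)).2, (if d then (x, y) else (y, x)).1)) = (x, y) := by
          cases d <;> rfl
        refine ⟨(if d then (x, y) else (y, x)).1 :: (if d then (x, y) else (y, x)).2 :: cs, ?_⟩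
        rw [← List.take_append_drop i s, flat_append, List.append_assoc,
          isTrace_double_cup _ _ _ _ _ _ _ _ _ _ hp, ← List.append_assoc, ← flat_append,
          ← List.append_assoc, ← flat_append, hxy]
        simpa using hcs
    · simp only [IsTrace] at h
      split at h
      · rename_i a d b e r' hd
        obtain ⟨p, rfl, rfl⟩ := eq_append_of_drop_eq hd
        obtain ⟨hde, hab, h⟩ := h
        obtain ⟨cs, hcs⟩ := ih _ _ h
        refine ⟨cs, ?_⟩
        rw [flat_append, flat_cons, flat_cons (b, e), ← List.append_assoc (flat [(a, d)]),
          ← flat_append, List.append_assoc, List.append_assoc]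
        rw [List.singleton_append, isTrace_double_cap _ _ _ _ _ _ _ _ hde _ _ _ (length_flat p),
          ← List.append_assoc, ← flat_append]
        exact ⟨hab, by simpa using hcs⟩
      · exact h.elim

end KnotDiag

namespace KnotDiag

/-! ### The band with framing `0` -/

section Band

variable {V : Type*} [AddCommGroup V]

/-- The parallel double of a kink is a full twist of the two strands together with a kink in each of
them. In a quandle the latter are invisible. -/
theorem isTrace_untwist (Q : LinRack V) (hQ : ∀ x, Q.L x = x - Q.T x) (k : ℕ) (a : V × V)
    (r : List (V × Bool)) (cs : List V) (s' : List (V × Bool)) :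
    IsTrace Q (List.replicate (2 * k) (.cross 0 false)) (flat [(a, true)] ++ r) cs s' ↔
      s' = flat [(Q.double.kink^[k] a, true)] ++ r ∧ cs = [] := by
  induction k generalizing a with
  | zero => simp [IsTrace]
  | succ k ih =>
    have h : Q.double.kink a = (Q.under a.2 false a.1,
        Q.under (Q.under a.2 false a.1) false a.2) := by
      ext <;> simp [LinRack.kink, LinRack.double, LinRack.under, hQ] <;> abel
    rw [Function.iterate_succ_apply, ← ih, show 2 * (k + 1) = 2 * k + 1 + 1 by ring,
      List.replicate_succ, List.replicate_succ, h]
    simp [IsTrace, flat]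

theorem LinRack.kink_iterate_unkink_iterate (Q : LinRack V) (k : ℕ) (x : V) :
    Q.kink^[k] (Q.unkink^[k] x) = x :=
  Function.LeftInverse.iterate (f := Q.unkink) (g := Q.kink) Q.kink_unkink k x

theorem zeroFramedBand_connectedSum (m : ℕ) :
    zeroFramedBand true (connectedSum m (whiteheadDouble trefoil)) =
      (connectedSum m (whiteheadDouble trefoil)).flatMap (doubleLetter true) ++
        List.replicate (2 * (8 * m)) (.cross 0 false) := by
  rw [zeroFramedBand, writhe_connectedSum, halfTwists]
  congr 2
  · omega
  · simp

/-- The companion contributes `8 * m` inverse kinks of the doubled rack, and the `8 * m` full twists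
undo them. The last clause serves to show that the bottom colours generate all the others. -/
theorem eq_of_isTrace_zeroFramedBand (Q : LinRack V) (hQ : ∀ x, Q.L x = x - Q.T x) (m : ℕ)
    (x y : V) (r : List (V × Bool)) (cs : List V) (s' : List (V × Bool))
    (h : IsTrace Q (zeroFramedBand true (connectedSum m (whiteheadDouble trefoil)))
      ((x, true) :: (y, true) :: r) cs s') :
    s' = (x, true) :: (y, true) :: r ∧ (x = 0 → y = 0 → ∀ z ∈ cs, z = 0) := by
  rw [zeroFramedBand_connectedSum, isTrace_append] at h
  obtain ⟨cs₁, cs₂, s₁, rfl, h₁, h₂⟩ := h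
  obtain ⟨cs₃, s₃, h₃, rfl, h₅⟩ := exists_isTrace_of_double Q _ [((x, y), true)] r cs₁ s₁
    (fits_connectedSum m) h₁
  obtain ⟨rfl, rfl⟩ := (isTrace_connectedSum _ _ _ _ _).1 h₃
  obtain ⟨rfl, rfl⟩ := (isTrace_untwist Q hQ _ _ _ _ _).1 h₂
  rw [LinRack.kink_iterate_unkink_iterate]
  refine ⟨rfl, ?_⟩
  rintro rfl rfl
  simpa using h₅ (minima_zero _ m)

theorem exists_isTrace_zeroFramedBand (Q : LinRack V) (hQ : ∀ x, Q.L x = x - Q.T x) (m : ℕ)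
    (x y : V) (r : List (V × Bool)) :
    ∃ cs, IsTrace Q (zeroFramedBand true (connectedSum m (whiteheadDouble trefoil)))
      ((x, true) :: (y, true) :: r) cs ((x, true) :: (y, true) :: r) := by
  obtain ⟨cs, h⟩ := exists_isTrace_double Q _ [((x, y), true)] r _ _
    ((isTrace_connectedSum Q.double m (x, y) _ _).2 ⟨rfl, rfl⟩)
  refine ⟨cs, ?_⟩
  rw [zeroFramedBand_connectedSum, isTrace_append]
  refine ⟨cs, [], _, by simp, h, (isTrace_untwist Q hQ _ _ _ _ _).2 ⟨?_, rfl⟩⟩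
  rw [LinRack.kink_iterate_unkink_iterate]
  rfl

end Band

/-! ### Colourings of the pretzel part by a module -/

variable {S M : Type*} [CommRing S] [AddCommGroup M] [Module S M]

/-- The Alexander quandle of a module with respect to a unit `t`. -/
def alexanderQuandle (M : Type*) [AddCommGroup M] [Module S M] (t : Sˣ) : LinRack M where
  T :=
    { toFun := fun x => (t : S) • x
      invFun := fun x => ((t⁻¹ : Sˣ) : S) • x
      left_inv := fun x => by simp [smul_smul]
      right_inv := fun x => by simp [smul_smul]
      map_add' := fun x y => smul_add _ _ _ }
  L :=
    { toFun := fun x => (1 - (t : S)) • x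
      map_zero' := smul_zero _
      map_add' := fun x y => smul_add _ _ _ }
  L_T := fun x => by simp [smul_smul, mul_comm]
  L_L := fun x => by simp [sub_smul, smul_sub]

theorem alexanderQuandle_L (t : Sˣ) (x : M) : (alexanderQuandle M t).L x =
    x - (alexanderQuandle M t).T x := by
  simp [alexanderQuandle, sub_smul]

theorem alexanderQuandle_under_true (t : Sˣ) (a b : M) : (alexanderQuandle M t).under a true b =
    a - ((t⁻¹ : Sˣ) : S) • (a - b) := by
  simp [alexanderQuandle, LinRack.under, sub_smul, smul_sub, smul_smul]
  abel

theorem alexanderQuandle_under_false (t : Sˣ) (a b : M) : (alexanderQuandle M t).under a false b =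
    a - (t : S) • (a - b) := by
  simp [alexanderQuandle, LinRack.under, sub_smul, smul_sub]
  abel

/-- The sum `1 - s + s ^ 2 - … ` with `k` terms. -/
def altGeom (s : S) : ℕ → S
  | 0 => 0
  | k + 1 => 1 - s * altGeom s k

/-- Each half-twist multiplies the difference of the two colours by `-t⁻¹`, so the colours run
through the partial sums of an alternating geometric series. -/
theorem isTrace_twist_up (t : Sˣ) (k : ℕ) (w : List Letter) (p r : List (M × Bool)) (a b : M)
    (cs : List M) (s' : List (M × Bool)) :
    IsTrace (alexanderQuandle M t) (List.replicate k (.cross p.length true) ++ w)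
      (p ++ (a, true) :: (b, true) :: r) cs s' ↔
    IsTrace (alexanderQuandle M t) w
      (p ++ (b + altGeom ((t⁻¹ : Sˣ) : S) (k + 1) • (a - b), true) ::
        (b + altGeom ((t⁻¹ : Sˣ) : S) k • (a - b), true) :: r) cs s' := by
  induction k generalizing a b with
  | zero => simp [altGeom]
  | succ k ih =>
    rw [List.replicate_succ, List.cons_append, isTrace_cross_true_append _ _ 0 _ _ _ _ (add_zero _).symm]
    simp only [List.drop, List.take, List.nil_append]
    rw [ih, alexanderQuandle_under_true]
    generalize ((t⁻¹ : Sˣ) : S) = g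
    have h₁ : a + altGeom g (k + 1) • (a - g • (a - b) - a) =
        b + altGeom g (k + 1 + 1) • (a - b) := by
      rw [altGeom.eq_2 _ (k + 1)]
      module
    have h₂ : a + altGeom g k • (a - g • (a - b) - a) = b + altGeom g (k + 1) • (a - b) := by
      rw [altGeom.eq_2 _ k]
      module
    rw [h₁, h₂]

theorem isTrace_twist_down (t : Sˣ) (k : ℕ) (w : List Letter) (p r : List (M × Bool)) (a b : M)
    (cs : List M) (s' : List (M × Bool)) :
    IsTrace (alexanderQuandle M t) (List.replicate k (.cross p.length false) ++ w)
      (p ++ (a, false) :: (b, false) :: r) cs s' ↔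
    IsTrace (alexanderQuandle M t) w
      (p ++ (a - altGeom ((t⁻¹ : Sˣ) : S) k • (a - b), false) ::
        (a - altGeom ((t⁻¹ : Sˣ) : S) (k + 1) • (a - b), false) :: r) cs s' := by
  induction k generalizing a b with
  | zero => simp [altGeom]
  | succ k ih =>
    rw [List.replicate_succ, List.cons_append, isTrace_cross_false_append _ _ 0 _ _ _ _ (add_zero _).symm]
    simp only [List.drop, List.take, List.nil_append, Bool.not_false]
    rw [ih, alexanderQuandle_under_true]
    generalize ((t⁻¹ : Sˣ) : S) = g
    have h₁ : b - altGeom g k • (b - (b - g • (b - a))) = a - altGeom g (k + 1) • (a - b) := by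
      rw [altGeom.eq_2 _ k]
      module
    have h₂ : b - altGeom g (k + 1) • (b - (b - g • (b - a))) =
        a - altGeom g (k + 1 + 1) • (a - b) := by
      rw [altGeom.eq_2 _ (k + 1)]
      module
    rw [h₁, h₂]

/-- A full twist preserves the difference `a - b` and translates both colours by `(1 - t⁻¹) (a -
b)`, so the growth is linear in `k`. -/
theorem isTrace_twist_antiparallel (t : Sˣ) (k : ℕ) (w : List Letter) (p r : List (M × Bool))
    (a b : M) (cs : List M) (s' : List (M × Bool)) :
    IsTrace (alexanderQuandle M t) (List.replicate (2 * k) (.cross p.length true) ++ w)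
      (p ++ (a, true) :: (b, false) :: r) cs s' ↔
    IsTrace (alexanderQuandle M t) w
      (p ++ (a + ((k : S) * (1 - ((t⁻¹ : Sˣ) : S))) • (a - b), true) ::
        (b + ((k : S) * (1 - ((t⁻¹ : Sˣ) : S))) • (a - b), false) :: r) cs s' := by
  induction k generalizing a b with
  | zero => simp
  | succ k ih =>
    have ht : (t : S) * ((t⁻¹ : Sˣ) : S) = 1 := by simp
    rw [show 2 * (k + 1) = 2 * k + 1 + 1 by ring, List.replicate_succ, List.replicate_succ,
      List.cons_append, List.cons_append, isTrace_cross_true_append _ _ 0 _ _ _ _ (add_zero _).symm]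
    simp only [List.drop, List.take, List.nil_append]
    rw [isTrace_cross_true_append _ _ 0 _ _ _ _ (add_zero _).symm]
    simp only [List.drop, List.take, List.nil_append]
    rw [ih, alexanderQuandle_under_true, alexanderQuandle_under_false]
    push_cast
    generalize ((t⁻¹ : Sˣ) : S) = g at ht
    generalize (t : S) = f at ht
    have h₁ : a - g • (a - b) - f • (a - g • (a - b) - a) = a - g • (a - b) + (a - b) := by
      linear_combination (norm := module) ht • (a - b)
    have h₂ : a - g • (a - b) + (a - b) + (k * (1 - g)) • (a - g • (a - b) + (a - b) -
        (a - g • (a - b))) = a + ((k + 1) * (1 - g)) • (a - b) := by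
      module
    have h₃ : a - g • (a - b) + (k * (1 - g)) • (a - g • (a - b) + (a - b) -
        (a - g • (a - b))) = b + ((k + 1) * (1 - g)) • (a - b) := by
      module
    rw [h₁, h₂, h₃]

/-- The part of `K n J` above the three lowest local minima. -/
def upperPart (n : ℕ) (J : List Letter) : List Letter :=
  zeroFramedBand true J ++ (halfTwists 0 n ++ (halfTwists 2 (-n) ++ (halfTwists 4 (n - 1) ++
    [.cap 1, .cap 1, .cap 0])))

theorem K_eq (n : ℕ) (J : List Letter) :
    K n J = [.cup 0 true, .cup 1 true, .cup 3 false] ++ upperPart n J := by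
  simp [K, upperPart]

theorem isTrace_pretzel (t : Sˣ) (k : ℕ) (u v w : M) (cs : List M) (s' : List (M × Bool)) :
    IsTrace (alexanderQuandle M t) (halfTwists 0 ((2 * k + 1 : ℕ) : ℤ) ++
      (halfTwists 2 (-((2 * k + 1 : ℕ) : ℤ)) ++ (halfTwists 4 (((2 * k + 1 : ℕ) : ℤ) - 1) ++
        [.cap 1, .cap 1, .cap 0])))
      [(u, true), (v, true), (v, false), (w, false), (w, true), (u, false)] cs s' ↔
    altGeom ((t⁻¹ : Sˣ) : S) (2 * k + 1) • (u - w) = 0 ∧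
    (((t⁻¹ : Sˣ) : S) * altGeom ((t⁻¹ : Sˣ) : S) (2 * k + 1)) • (v - w) =
      ((k : S) * (1 - ((t⁻¹ : Sˣ) : S))) • (w - u) ∧ s' = [] ∧ cs = [] := by
  have h₁ : halfTwists 0 ((2 * k + 1 : ℕ) : ℤ) = List.replicate (2 * k + 1) (.cross 0 true) := by
    rw [halfTwists]
    congr 2
    simp
  have h₂ : halfTwists 2 (-((2 * k + 1 : ℕ) : ℤ)) =
      List.replicate (2 * k + 1) (.cross 2 false) := by
    rw [halfTwists]
    congr 1
  have h₃ : halfTwists 4 (((2 * k + 1 : ℕ) : ℤ) - 1) = List.replicate (2 * k) (.cross 4 true) := by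
    -- For `k = 0` the test `0 < n - 1` in `halfTwists` fails, but the list is empty.
    rcases k.eq_zero_or_pos with rfl | hk
    · rfl
    · rw [halfTwists]
      congr 1
      · omega
      · simp; omega
  rw [h₁, h₂, h₃]
  generalize hg : ((t⁻¹ : Sˣ) : S) = g
  have e₁ := isTrace_twist_up (M := M) t (2 * k + 1) (List.replicate (2 * k + 1) (.cross 2 false) ++
    (List.replicate (2 * k) (.cross 4 true) ++ [.cap 1, .cap 1, .cap 0])) []
    [(v, false), (w, false), (w, true), (u, false)] u v cs s'
  simp only [List.length_nil, List.nil_append] at e₁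
  rw [e₁]
  generalize hx : v + altGeom ((t⁻¹ : Sˣ) : S) (2 * k + 1 + 1) • (u - v) = x
  generalize hy : v + altGeom ((t⁻¹ : Sˣ) : S) (2 * k + 1) • (u - v) = y
  have e₂ := isTrace_twist_down (M := M) t (2 * k + 1) (
    (List.replicate (2 * k) (.cross 4 true) ++ [.cap 1, .cap 1, .cap 0])) [(x, true), (y, true)]
    [(w, true), (u, false)] v w cs s'
  simp only [List.length_nil, List.length_cons, zero_add, Nat.reduceAdd, List.cons_append,
    List.nil_append] at e₂
  rw [e₂]
  generalize hx' : v - altGeom ((t⁻¹ : Sˣ) : S) (2 * k + 1) • (v - w) = x'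
  generalize hy' : v - altGeom ((t⁻¹ : Sˣ) : S) (2 * k + 1 + 1) • (v - w) = y'
  have e₃ := isTrace_twist_antiparallel (M := M) t k [.cap 1, .cap 1, .cap 0]
    [(x, true), (y, true), (x', false), (y', false)] [] w u cs s'
  simp only [List.length_nil, List.length_cons, zero_add, Nat.reduceAdd, List.cons_append,
    List.nil_append] at e₃
  rw [e₃]
  simp only [IsTrace, List.drop, List.take, ne_eq, Bool.false_eq_true, not_false_eq_true, true_and,
    List.nil_append, List.cons_append, Bool.true_eq_false]
  rw [hg] at hx hy hx' hy'
  rw [altGeom] at hx hy'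
  rw [hg]
  generalize altGeom g (2 * k + 1) = G at *
  subst hx hy hx' hy'
  constructor
  · rintro ⟨c₁, c₂, c₃, c₄⟩
    refine ⟨?_, ?_, c₄⟩
    · linear_combination (norm := module) c₁
    · linear_combination (norm := module) c₂
  · rintro ⟨c₁, c₂, c₄⟩
    refine ⟨?_, ?_, ?_, c₄⟩
    · linear_combination (norm := module) c₁
    · linear_combination (norm := module) c₂
    -- The equation at the last cap follows from the other two, as one relation of a knot diagram is
    -- always redundant.
    · linear_combination (norm := module) c₂ - g • c₁

theorem relations_of_isTrace_upperPart (t : Sˣ) (k m : ℕ) (u v w : M) (cs : List M)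
    (s' : List (M × Bool)) (h : IsTrace (alexanderQuandle M t)
      (upperPart (2 * k + 1) (connectedSum m (whiteheadDouble trefoil)))
      [(u, true), (v, true), (v, false), (w, false), (w, true), (u, false)] cs s') :
    altGeom ((t⁻¹ : Sˣ) : S) (2 * k + 1) • (u - w) = 0 ∧
    (((t⁻¹ : Sˣ) : S) * altGeom ((t⁻¹ : Sˣ) : S) (2 * k + 1)) • (v - w) =
      ((k : S) * (1 - ((t⁻¹ : Sˣ) : S))) • (w - u) ∧ (u = 0 → v = 0 → ∀ z ∈ cs, z = 0) := by
  rw [upperPart, isTrace_append] at h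
  obtain ⟨cs₁, cs₂, s₁, rfl, h₁, h₂⟩ := h
  obtain ⟨rfl, hz⟩ := eq_of_isTrace_zeroFramedBand _ (alexanderQuandle_L t) _ _ _ _ _ _ h₁
  obtain ⟨h₃, h₄, -, rfl⟩ := (isTrace_pretzel _ _ _ _ _ _ _).1 h₂
  exact ⟨h₃, h₄, by simpa using hz⟩

theorem exists_isTrace_upperPart (t : Sˣ) (k m : ℕ) (u v w : M)
    (h₁ : altGeom ((t⁻¹ : Sˣ) : S) (2 * k + 1) • (u - w) = 0)
    (h₂ : (((t⁻¹ : Sˣ) : S) * altGeom ((t⁻¹ : Sˣ) : S) (2 * k + 1)) • (v - w) =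
      ((k : S) * (1 - ((t⁻¹ : Sˣ) : S))) • (w - u)) :
    ∃ cs, IsTrace (alexanderQuandle M t)
      (upperPart (2 * k + 1) (connectedSum m (whiteheadDouble trefoil)))
      [(u, true), (v, true), (v, false), (w, false), (w, true), (u, false)] cs [] := by
  obtain ⟨cs, h⟩ := exists_isTrace_zeroFramedBand _ (alexanderQuandle_L t) m u v
    [(v, false), (w, false), (w, true), (u, false)]
  refine ⟨cs, ?_⟩
  rw [upperPart, isTrace_append]
  exact ⟨cs, [], _, by simp, h, (isTrace_pretzel _ _ _ _ _ _ _).2 ⟨h₁, h₂, rfl, rfl⟩⟩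

end KnotDiag

namespace KnotDiag

/-! ### Minors -/

section Minors

variable {R : Type*} [CommRing R]

/-- Minors of matrices whose rows are linear combinations of the rows of `A` lie in the ideal that
the minors of `A` generate. -/
theorem det_mem_span_minors {r N n : ℕ} (A : Matrix (Fin r) (Fin N) R) (B : Fin n → Fin N → R)
    (hB : ∀ i, B i ∈ Submodule.span R (Set.range A)) (g : Fin n → Fin N) :
    (Matrix.of fun i j => B i (g j)).det ∈ Ideal.span {x | ∃ (f : Fin n → Fin r)
      (g : Fin n → Fin N), x = (A.submatrix f g).det} := by
  choose c hc using fun i => (Submodule.mem_span_range_iff_exists_fun R).1 (hB i)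
  have h : (Matrix.of fun i j => B i (g j)).det =
      Matrix.detRowAlternating fun i => ∑ k, c i k • fun j => A k (g j) := by
    congr 1
    ext i j
    simp [← hc i]
  rw [h, ← AlternatingMap.coe_multilinearMap, MultilinearMap.map_sum]
  refine Ideal.sum_mem _ fun f _ => ?_
  rw [MultilinearMap.map_smul_univ, smul_eq_mul]
  exact Ideal.mul_mem_left _ _ (Ideal.subset_span ⟨f, g, rfl⟩)

/-- The enumeration of the columns other than the column `2`. -/
def skipTwo {k : ℕ} : Fin (k + 2) → Fin (k + 3) :=
  Fin.cons 0 (Fin.cons 1 fun i => i.succ.succ.succ)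

theorem skipTwo_zero {k : ℕ} : (skipTwo 0 : Fin (k + 3)) = 0 := rfl

theorem skipTwo_one {k : ℕ} : (skipTwo 1 : Fin (k + 3)) = 1 := rfl

theorem skipTwo_succ_succ {k : ℕ} (i : Fin k) : skipTwo i.succ.succ = i.succ.succ.succ := rfl

theorem val_two_fin (k : ℕ) : ((2 : Fin (k + 3)) : ℕ) = 2 := rfl

theorem skipTwo_ne_two {k : ℕ} (i : Fin (k + 2)) : skipTwo i ≠ 2 := by
  intro h
  have h := congrArg Fin.val h
  rw [val_two_fin] at h
  induction i using Fin.cases with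
  | zero => simp [skipTwo_zero] at h
  | succ i =>
    induction i using Fin.cases with
    | zero => exact absurd h (by simp [skipTwo_one])
    | succ i => rw [skipTwo_succ_succ] at h; simp at h

theorem sum_eq_add_sum_skipTwo {k : ℕ} {M : Type*} [AddCommMonoid M] (F : Fin (k + 3) → M) :
    ∑ j, F j = F 2 + ∑ i, F (skipTwo i) := by
  simp only [Fin.sum_univ_succ, ← skipTwo_succ_succ]
  change F 0 + (F 1 + (F 2 + _)) = F 2 + (F 0 + (F 1 + _))
  rw [add_left_comm (F 2), add_left_comm (F 2)]

/-- A square matrix that is lower triangular, with the diagonal entries `a`, `b`, `1`, …, `1`. -/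
theorem det_lower_triangular {k : ℕ} (B : Matrix (Fin (k + 2)) (Fin (k + 2)) R) (a b : R)
    (h₀ : B 0 0 = a) (h₁ : B 1 1 = b) (h₀₁ : B 0 1 = 0)
    (h : ∀ i (j : Fin k), B i j.succ.succ = if i = j.succ.succ then 1 else 0) :
    B.det = a * b := by
  rw [Matrix.det_of_isLowerTriangular]
  · rw [Fin.prod_univ_succ, Fin.prod_univ_succ, Finset.prod_eq_one, mul_one, h₀]
    · exact congrArg _ h₁
    · intro i _
      rw [h, if_pos rfl]
  · intro i j hij
    have hij : i < j := hij
    induction j using Fin.cases with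
    | zero => exact absurd hij (Fin.not_lt_zero i)
    | succ j =>
      induction j using Fin.cases with
      | zero =>
        have : i = 0 := by
          ext
          have : (i : ℕ) < 1 := hij
          simpa using this
        rw [this]
        exact h₀₁
      | succ j => rw [h, if_neg hij.ne]

/-- The two relations and the eliminations of the generators beyond the first three are combinations
of rows of `A`. Without column `2` they form a lower triangular matrix with diagonal `q, q, 1, …,
1`. -/
theorem sq_mem_span_minors {r k : ℕ} (A : Matrix (Fin r) (Fin (k + 3)) R) (q κ : R)
    (h₁ : Pi.single 0 q - Pi.single 2 q ∈ Submodule.span R (Set.range A))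
    (h₂ : Pi.single 1 q - Pi.single 2 q - (Pi.single 0 κ - Pi.single 2 κ) ∈
      Submodule.span R (Set.range A))
    (h₃ : ∀ j, ∃ x y z : R, Pi.single j 1 - (Pi.single 0 x + Pi.single 1 y + Pi.single 2 z) ∈
      Submodule.span R (Set.range A)) :
    q ^ 2 ∈ Ideal.span {x | ∃ (f : Fin (k + 2) → Fin r) (g : Fin (k + 2) → Fin (k + 3)),
      x = (A.submatrix f g).det} := by
  choose x y z h₃ using h₃
  let B : Fin (k + 2) → Fin (k + 3) → R := Fin.cons (Pi.single 0 q - Pi.single 2 q)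
    (Fin.cons (Pi.single 1 q - Pi.single 2 q - (Pi.single 0 κ - Pi.single 2 κ)) fun i =>
      Pi.single i.succ.succ.succ 1 - (Pi.single 0 (x i.succ.succ.succ) +
        Pi.single 1 (y i.succ.succ.succ) + Pi.single 2 (z i.succ.succ.succ)))
  have hB : ∀ i, B i ∈ Submodule.span R (Set.range A) := by
    intro i
    refine Fin.cases h₁ (fun i => ?_) i
    exact Fin.cases h₂ (fun i => h₃ _) i
  have hdet : (Matrix.of fun i j => B i (skipTwo j)).det = q ^ 2 := by
    rw [sq]
    refine det_lower_triangular _ _ _ ?_ ?_ ?_ fun i j => ?_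
    · change (Pi.single 0 q - Pi.single 2 q : Fin (k + 3) → R) (skipTwo 0) = q
      rw [Pi.sub_apply, Pi.single_eq_of_ne (skipTwo_ne_two _)]
      simp [skipTwo_zero]
    · change (Pi.single 1 q - Pi.single 2 q - (Pi.single 0 κ - Pi.single 2 κ) :
        Fin (k + 3) → R) (skipTwo 1) = q
      rw [Pi.sub_apply, Pi.sub_apply, Pi.sub_apply, Pi.single_eq_of_ne (skipTwo_ne_two _),
        Pi.single_eq_of_ne (skipTwo_ne_two _)]
      simp [skipTwo_one]
    · change (Pi.single 0 q - Pi.single 2 q : Fin (k + 3) → R) (skipTwo 1) = 0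
      rw [Pi.sub_apply, Pi.single_eq_of_ne (skipTwo_ne_two _)]
      simp [skipTwo_one]
    · have h2 : ∀ a : R, (Pi.single 2 a : Fin (k + 3) → R) j.succ.succ.succ = 0 :=
        fun a => Pi.single_eq_of_ne (skipTwo_ne_two j.succ.succ) _
      rw [Matrix.of_apply, skipTwo_succ_succ]
      induction i using Fin.cases with
      | zero =>
        change (Pi.single 0 q - Pi.single 2 q : Fin (k + 3) → R) j.succ.succ.succ = _
        rw [Pi.sub_apply, h2]
        simp [Fin.ext_iff]
      | succ i =>
        induction i using Fin.cases with
        | zero =>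
          change (Pi.single 1 q - Pi.single 2 q - (Pi.single 0 κ - Pi.single 2 κ) :
            Fin (k + 3) → R) j.succ.succ.succ = _
          rw [Pi.sub_apply, Pi.sub_apply, Pi.sub_apply, h2, h2]
          simp [Fin.ext_iff]
        | succ i =>
          change (Pi.single i.succ.succ.succ 1 - (Pi.single 0 (x i.succ.succ.succ) +
            Pi.single 1 (y i.succ.succ.succ) + Pi.single 2 (z i.succ.succ.succ)) :
            Fin (k + 3) → R) j.succ.succ.succ = _
          rw [Pi.sub_apply, Pi.add_apply, Pi.add_apply, h2]
          simp [Pi.single_apply, Fin.ext_iff, eq_comm]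
  rw [← hdet]
  exact det_mem_span_minors A B hB skipTwo

/-- The vectors `v j` define a map to the module presented by `(q, 0)` and `(-κ, q)`. A unimodular
column operation turns the first two columns of `A` into the images of its rows in `R × R`, from
which the small presentation matrix can be factored out. -/
theorem sq_dvd_minor {r k : ℕ} (A : Matrix (Fin r) (Fin (k + 3)) R) (q κ : R)
    (hA : ∀ i, ∑ j, A i j = 0) (v : Fin (k + 3) → R × R) (h0 : v 0 = (1, 0)) (h1 : v 1 = (0, 1))
    (h2 : v 2 = 0)
    (hv : ∀ i, ∃ x y : R, ∑ j, A i j • v j = x • (q, (0 : R)) + y • (-κ, q))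
    (f : Fin (k + 2) → Fin r) (g : Fin (k + 2) → Fin (k + 3)) :
    q ^ 2 ∣ (A.submatrix f g).det := by
  choose x y hv using hv
  -- As the rows sum to zero, column `2` is minus the sum of the others. So any choice of columns,
  -- even with repetitions, factors through the columns other than `2`.
  have e₁ : A.submatrix f g = A.submatrix f skipTwo *
      Matrix.of fun i j => (if skipTwo i = g j then 1 else 0) - (if g j = 2 then 1 else 0) := by
    ext i j
    have hs := hA (f i)
    rw [sum_eq_add_sum_skipTwo] at hs
    have h := sum_eq_add_sum_skipTwo fun l => A (f i) l * if l = g j then 1 else 0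
    simp only [mul_ite, mul_one, mul_zero, Finset.sum_ite_eq', Finset.mem_univ, if_true] at h
    rw [Matrix.submatrix_apply, h]
    simp only [Matrix.mul_apply, Matrix.submatrix_apply, Matrix.of_apply, mul_sub,
      Finset.sum_sub_distrib, mul_ite, mul_one, mul_zero, eq_comm (a := g j)]
    by_cases hg : 2 = g j
    · simp only [if_pos hg]
      linear_combination hs
    · simp [if_neg hg]
  -- `E` is the column operation, `Y` the small presentation matrix extended by an identity block,
  -- and `X` contains the coefficients `x`, `y` and the untouched columns.
  let E : Matrix (Fin (k + 2)) (Fin (k + 2)) R := Matrix.of fun i =>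
    Fin.cons (v (skipTwo i)).1 (Fin.cons (v (skipTwo i)).2 fun j => if i = j.succ.succ then 1 else 0)
  let X : Matrix (Fin (k + 2)) (Fin (k + 2)) R := Matrix.of fun i =>
    Fin.cons (x (f i)) (Fin.cons (y (f i)) fun j => A (f i) j.succ.succ.succ)
  let Y : Matrix (Fin (k + 2)) (Fin (k + 2)) R := Matrix.of
    (Fin.cons (Fin.cons q 0) (Fin.cons (Fin.cons (-κ) (Fin.cons q 0)) fun i =>
      Pi.single i.succ.succ 1))
  have hE : E.det = 1 := by
    rw [det_lower_triangular E 1 1 _ _ _ fun i j => rfl, one_mul]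
    · simp [E, skipTwo_zero, h0]
    · simp [E, skipTwo_one, h1, Fin.cons_one]
    · simp [E, skipTwo_zero, h0, Fin.cons_one]
  have hY : Y.det = q ^ 2 := by
    rw [sq]
    refine det_lower_triangular Y _ _ rfl rfl rfl fun i j => ?_
    induction i using Fin.cases with
    | zero => simp [Y, Fin.ext_iff]
    | succ i =>
      induction i using Fin.cases with
      | zero => simp [Y, Fin.ext_iff]
      | succ i => simp [Y, Pi.single_apply, eq_comm]
  have hXY : A.submatrix f skipTwo * E = X * Y := by
    ext i j
    have hvi := hv (f i)
    rw [sum_eq_add_sum_skipTwo, h2, smul_zero, zero_add] at hvi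
    have hv₁ := congrArg Prod.fst hvi
    have hv₂ := congrArg Prod.snd hvi
    simp only [Prod.fst_sum, Prod.snd_sum, Prod.smul_fst, Prod.smul_snd, Prod.fst_add, Prod.snd_add,
      smul_eq_mul] at hv₁ hv₂
    have hR : (X * Y) i j = x (f i) * Y 0 j + (y (f i) * Y 1 j +
        ∑ l : Fin k, A (f i) l.succ.succ.succ * Y l.succ.succ j) := by
      rw [Matrix.mul_apply, Fin.sum_univ_succ, Fin.sum_univ_succ]
      rfl
    rw [hR, Matrix.mul_apply]
    induction j using Fin.cases with
    | zero =>
      refine hv₁.trans ?_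
      simp [Y]
    | succ j =>
      induction j using Fin.cases with
      | zero =>
        refine hv₂.trans ?_
        simp [Y, Fin.ext_iff]
      | succ j =>
        have hl : ∑ l, A.submatrix f skipTwo i l * E l j.succ.succ = A (f i) j.succ.succ.succ := by
          simp [E, skipTwo_succ_succ]
        rw [hl]
        simp [Y, Pi.single_apply]
  have : (A.submatrix f skipTwo).det = X.det * q ^ 2 := by
    rw [← hY, ← Matrix.det_mul, ← hXY, Matrix.det_mul, hE, mul_one]
  rw [e₁, Matrix.det_mul, this]
  exact Dvd.intro_left _ rfl |>.mul_right _

end Minors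

/-! ### The Alexander matrix -/

open LaurentPolynomial

section Rows

variable {M : Type*} [AddCommGroup M] [Module ℤ[T;T⁻¹] M]

/-- The unit `t` of the ring of Laurent polynomials. -/
noncomputable def tUnit : (ℤ[T;T⁻¹])ˣ where
  val := T 1
  inv := T (-1)
  val_inv := by rw [← T_add]; simp
  inv_val := by rw [← T_add]; simp

theorem sum_ite_smul {N : ℕ} (c : ℕ → M) {a : ℕ} (ha : a < N) (x : ℤ[T;T⁻¹]) :
    ∑ j : Fin N, (if (j : ℕ) = a then x else 0) • c j = x • c a := by
  rw [Finset.sum_eq_single ⟨a, ha⟩]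
  · simp
  · intro b _ hb
    rw [if_neg (fun h => hb (Fin.ext h)), zero_smul]
  · simp

theorem sum_crossingRow_smul {N : ℕ} (c : ℕ → M) {x : ℕ × ℕ × ℕ} (h₁ : x.1 < N) (h₂ : x.2.1 < N)
    (h₃ : x.2.2 < N) : ∑ j : Fin N, crossingRow x j • c j =
      (alexanderQuandle M tUnit).L (c x.1) + (alexanderQuandle M tUnit).T (c x.2.1) - c x.2.2 := by
  simp only [crossingRow, add_smul, sub_smul _ _ (c _), Finset.sum_add_distrib,
    Finset.sum_sub_distrib, sum_ite_smul c h₁, sum_ite_smul c h₂, sum_ite_smul c h₃]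
  simp [alexanderQuandle, tUnit, sub_smul]

theorem sum_joinRow_smul {N : ℕ} (c : ℕ → M) {x : ℕ × ℕ} (h₁ : x.1 < N) (h₂ : x.2 < N) :
    ∑ j : Fin N, joinRow x j • c j = c x.1 - c x.2 := by
  simp only [joinRow, sub_smul, Finset.sum_sub_distrib, sum_ite_smul c h₁, sum_ite_smul c h₂]
  simp

/-- On the arcs of `D`, colourings are thus the linear maps to `M` from the cokernel of the
Alexander matrix. -/
theorem isColoring_iff {D : Diagram} (hD : D.WellFormed) (c : ℕ → M) :
    D.IsColoring (alexanderQuandle M tUnit) c ↔ ∀ ρ ∈ D.rows, ∑ j, ρ j • c j = 0 := by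
  simp only [Diagram.rows, List.mem_append, List.mem_map, Diagram.IsColoring]
  constructor
  · rintro ⟨h₁, h₂⟩ ρ (⟨x, hx, rfl⟩ | ⟨x, hx, rfl⟩)
    · obtain ⟨a₁, a₂, a₃⟩ := hD.crossings x hx
      rw [sum_crossingRow_smul c a₁ a₂ a₃, h₁ x hx, sub_self]
    · obtain ⟨a₁, a₂⟩ := hD.joins x hx
      rw [sum_joinRow_smul c a₁ a₂, h₂ x hx, sub_self]
  · intro h
    refine ⟨fun x hx => ?_, fun x hx => ?_⟩
    · obtain ⟨a₁, a₂, a₃⟩ := hD.crossings x hx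
      have := h _ (Or.inl ⟨x, hx, rfl⟩)
      rw [sum_crossingRow_smul c a₁ a₂ a₃, sub_eq_zero] at this
      exact this.symm
    · obtain ⟨a₁, a₂⟩ := hD.joins x hx
      have := h _ (Or.inr ⟨x, hx, rfl⟩)
      rwa [sum_joinRow_smul c a₁ a₂, sub_eq_zero] at this

end Rows

theorem mul_altGeom {S : Type*} [CommRing S] (s : S) (k : ℕ) :
    (1 + s) * altGeom s k = 1 - (-s) ^ k := by
  induction k with
  | zero => simp [altGeom]
  | succ k ih => rw [altGeom, pow_succ]; linear_combination -s * ih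

end KnotDiag

namespace KnotDiag

open LaurentPolynomial

/-! ### The knot `K n J` -/

/-- The three lowest local minima of `K n J`. -/
def lowerPart : Diagram :=
  ⟨[(0, true), (1, true), (1, false), (2, false), (2, true), (0, false)], 3, [], [], 0⟩

theorem lowerPart_wellFormed : lowerPart.WellFormed := by
  constructor <;> simp [lowerPart]

theorem run_K (n : ℕ) (J : List Letter) :
    Diagram.empty.run (K n J) = lowerPart.run (upperPart n J) := by
  rw [K_eq, Diagram.run_append]
  rfl

/-! ### Colourings of the knot in terms of three generators. -/

section Colorings

variable {S M : Type*} [CommRing S] [AddCommGroup M] [Module S M] {k m : ℕ} {D : Diagram}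

theorem Diagram.IsColoring.relations (t : Sˣ)
    (hD : lowerPart.run (upperPart (2 * k + 1) (connectedSum m (whiteheadDouble trefoil))) = some D)
    {c : ℕ → M} (hc : D.IsColoring (alexanderQuandle M t) c) :
    altGeom ((t⁻¹ : Sˣ) : S) (2 * k + 1) • (c 0 - c 2) = 0 ∧
    (((t⁻¹ : Sˣ) : S) * altGeom ((t⁻¹ : Sˣ) : S) (2 * k + 1)) • (c 1 - c 2) =
      ((k : S) * (1 - ((t⁻¹ : Sˣ) : S))) • (c 2 - c 0) ∧
    (c 0 = 0 → c 1 = 0 → c 2 = 0 → ∀ a < D.arcs, c a = 0) := by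
  obtain ⟨cs, h, hz⟩ := hc.exists_isTrace hD
  obtain ⟨h₁, h₂, h₃⟩ := relations_of_isTrace_upperPart t k m (c 0) (c 1) (c 2) cs _ h
  refine ⟨h₁, h₂, fun c₀ c₁ c₂ a ha => ?_⟩
  rcases lt_or_ge a 3 with h | h
  · interval_cases a <;> assumption
  · exact hz (by simp [lowerPart, c₀, c₁, c₂]) (h₃ c₀ c₁) a h ha

theorem exists_isColoring_of_relations (t : Sˣ) (k m : ℕ) (u v w : M)
    (h₁ : altGeom ((t⁻¹ : Sˣ) : S) (2 * k + 1) • (u - w) = 0)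
    (h₂ : (((t⁻¹ : Sˣ) : S) * altGeom ((t⁻¹ : Sˣ) : S) (2 * k + 1)) • (v - w) =
      ((k : S) * (1 - ((t⁻¹ : Sˣ) : S))) • (w - u)) :
    ∃ D c, lowerPart.run (upperPart (2 * k + 1) (connectedSum m (whiteheadDouble trefoil))) = some D ∧
      D.strands = [] ∧ D.IsColoring (alexanderQuandle M t) c ∧ c 0 = u ∧ c 1 = v ∧ c 2 = w := by
  obtain ⟨cs, h⟩ := exists_isTrace_upperPart t k m u v w h₁ h₂
  let c : ℕ → M := fun j => if j = 0 then u else if j = 1 then v else w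
  have hc : lowerPart.IsColoring (alexanderQuandle M t) c := by
    constructor <;> simp [lowerPart]
  obtain ⟨D, c', hD, hcc, hc', htop⟩ := lowerPart_wellFormed.exists_isColoring (c := c) (cs := cs) hc h
  exact ⟨D, c', hD, List.map_eq_nil_iff.1 htop, hc', hcc 0 (by simp [lowerPart]),
    hcc 1 (by simp [lowerPart]), hcc 2 (by simp [lowerPart])⟩

/-- The zero colouring already shows that the pieces fit together, since a trace exists only for
words that do. -/
theorem exists_run (k m : ℕ) :
    ∃ D, lowerPart.run (upperPart (2 * k + 1) (connectedSum m (whiteheadDouble trefoil))) = some D ∧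
      D.strands = [] := by
  obtain ⟨D, -, hD, hs, -⟩ := exists_isColoring_of_relations (1 : ℤˣ) k m (0 : ℤ) 0 0
    (by simp) (by simp)
  exact ⟨D, hD, hs⟩

/-- A colouring by integers, where `t` acts trivially, is constant; so there is one component. -/
theorem isKnot
    (hD : lowerPart.run (upperPart (2 * k + 1) (connectedSum m (whiteheadDouble trefoil))) = some D)
    (hs : D.strands = []) : D.IsKnot := by
  classical
  have h3 : 3 ≤ D.arcs := (Diagram.run_mono hD).1
  have key : ∀ a < D.arcs, Relation.EqvGen D.Adjacent 0 a := by
    -- For `t = 1` a colouring is a function constant on components. This one vanishes exactly on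
    -- the component of arc `0`.
    let c : ℕ → ℤ := fun a => if Relation.EqvGen D.Adjacent 0 a then 0 else 1
    have hadj : ∀ a b, D.Adjacent a b → c a = c b := by
      intro a b hab
      have : Relation.EqvGen D.Adjacent 0 a ↔ Relation.EqvGen D.Adjacent 0 b :=
        ⟨fun h => h.trans _ _ _ (.rel _ _ hab), fun h => h.trans _ _ _ (.symm _ _ (.rel _ _ hab))⟩
      simp only [c, this]
    have hc : D.IsColoring (alexanderQuandle ℤ (1 : ℤˣ)) c := by
      refine ⟨fun x hx => ?_, fun x hx => hadj _ _ (Or.inr hx)⟩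
      rw [← hadj _ _ (Or.inl ⟨x.1, hx⟩)]
      simp [alexanderQuandle]
    obtain ⟨h₁, h₂, h₃⟩ := hc.relations 1 hD
    -- Here the oddness of `n` enters: the alternating sum `1 - 1 + … + 1` is a unit, so the three
    -- generators agree.
    have hg : altGeom (1 : ℤ) (2 * k + 1) = 1 := by
      have := mul_altGeom (1 : ℤ) (2 * k + 1)
      rw [pow_succ, pow_mul] at this
      norm_num at this
      omega
    have h0 : c 0 = 0 := if_pos (.refl _)
    simp [hg, h0] at h₁ h₂
    have h2 := h₁
    have h1 : c 1 = 0 := by omega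
    intro a ha
    by_contra hn
    have := h₃ h0 h1 h2 a ha
    simp [c, hn] at this
  exact ⟨hs, by omega, fun a ha b hb => (Relation.EqvGen.symm _ _ (key a ha)).trans _ _ _ (key b hb)⟩

end Colorings

/-! ### Minors obtained from colourings by quotient modules. -/

section Presentation

variable {R : Type*} [CommRing R] {r N : ℕ}

theorem sq_dvd_minor_of_coloring (hN : 3 ≤ N) (A : Matrix (Fin r) (Fin N) R) (q κ : R)
    (hA : ∀ i, ∑ j, A i j = 0)
    (c : ℕ → (R × R) ⧸ Submodule.span R {(q, (0 : R)), (-κ, q)})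
    (hc : ∀ i, ∑ j, A i j • c j = 0) (hc0 : c 0 = Submodule.mkQ _ (1, 0))
    (hc1 : c 1 = Submodule.mkQ _ (0, 1)) (hc2 : c 2 = 0)
    (f : Fin (N - 1) → Fin r) (g : Fin (N - 1) → Fin N) : q ^ 2 ∣ (A.submatrix f g).det := by
  obtain ⟨l, rfl⟩ : ∃ l, N = l + 3 := ⟨N - 3, by omega⟩
  choose v hv using fun j : Fin (l + 3) => Submodule.mkQ_surjective _ (c j)
  -- Arbitrary lifts of the colours suffice, except at the three generators, where the standard ones
  -- are needed.
  let v' : Fin (l + 3) → R × R := fun j =>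
    if j = 0 then (1, 0) else if j = 1 then (0, 1) else if j = 2 then 0 else v j
  have hv' : ∀ j, Submodule.mkQ _ (v' j) = c j := by
    intro j
    simp only [v']
    split_ifs with h₀ h₁ h₂
    · rw [h₀]; exact hc0.symm
    · rw [h₁]; exact hc1.symm
    · rw [h₂, map_zero]; exact hc2.symm
    · exact hv j
  refine sq_dvd_minor A q κ hA v' (if_pos rfl) ?_ ?_ (fun i => ?_) f g
  · simp [v']
  · have h₀ : (2 : Fin (l + 3)) ≠ 0 := (skipTwo_ne_two 0).symm
    have h₁ : (2 : Fin (l + 3)) ≠ 1 := (skipTwo_ne_two 1).symm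
    simp only [v', if_neg h₀, if_neg h₁, if_true]
  · have hmem : ∑ j, A i j • v' j ∈ Submodule.span R {(q, (0 : R)), (-κ, q)} := by
      rw [← Submodule.Quotient.mk_eq_zero, ← Submodule.mkQ_apply, map_sum, ← hc i]
      exact Finset.sum_congr rfl fun j _ => by rw [map_smul, hv']
    obtain ⟨a, b, hab⟩ := Submodule.mem_span_pair.1 hmem
    exact ⟨a, b, hab.symm⟩

theorem sq_mem_span_minors_of_coloring (hN : 3 ≤ N) (A : Matrix (Fin r) (Fin N) R) (q κ : R)
    (c : ℕ → (Fin N → R) ⧸ Submodule.span R (Set.range A))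
    (hc : ∀ j : Fin N, c j = Submodule.mkQ _ (Pi.single j 1))
    (h₁ : q • (c 0 - c 2) = 0) (h₂ : q • (c 1 - c 2) = κ • (c 0 - c 2))
    (h₃ : ∀ j : Fin N, c j ∈ Submodule.span R {c 0, c 1, c 2}) :
    q ^ 2 ∈ Ideal.span {x | ∃ (f : Fin (N - 1) → Fin r) (g : Fin (N - 1) → Fin N),
      x = (A.submatrix f g).det} := by
  obtain ⟨l, rfl⟩ : ∃ l, N = l + 3 := ⟨N - 3, by omega⟩
  have hs : ∀ (j : Fin (l + 3)) (a : R), (Pi.single j a : Fin (l + 3) → R) = a • Pi.single j 1 := by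
    intro j a
    rw [← Pi.single_smul, smul_eq_mul, mul_one]
  have c0 : c 0 = Submodule.mkQ _ (Pi.single 0 1) := hc 0
  have c1 : c 1 = Submodule.mkQ _ (Pi.single 1 1) := hc 1
  have c2 : c 2 = Submodule.mkQ _ (Pi.single 2 1) := hc 2
  refine sq_mem_span_minors A q κ ?_ ?_ fun j => ?_
  · rw [← Submodule.Quotient.mk_eq_zero, ← Submodule.mkQ_apply, ← h₁, c0, c2, hs, hs 2]
    simp only [map_sub, map_smul, smul_sub]
  · rw [← Submodule.Quotient.mk_eq_zero, ← Submodule.mkQ_apply, hs 1, hs 2, hs 0, hs 2 κ,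
      ← smul_sub, ← smul_sub, map_sub, map_smul, map_smul, map_sub, map_sub, ← c0, ← c1, ← c2, h₂,
      sub_self]
  · obtain ⟨x, y, z, h⟩ := Submodule.mem_span_triple.1 (h₃ j)
    refine ⟨x, y, z, ?_⟩
    rw [← Submodule.Quotient.mk_eq_zero, ← Submodule.mkQ_apply, hs 0, hs 1, hs 2]
    simp only [map_sub, map_add, map_smul, ← c0, ← c1, ← c2, ← hc, h, sub_self]

end Presentation

/-! ### The first elementary ideal of the knot. -/

section AlexanderIdeal

variable {M M₂ : Type*} [AddCommGroup M] [Module ℤ[T;T⁻¹] M] [AddCommGroup M₂] [Module ℤ[T;T⁻¹] M₂]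

/-- The quotient `(t ^ n + 1) / (t + 1)` for `n = 2 * k + 1`. -/
noncomputable def quot (k : ℕ) : ℤ[T;T⁻¹] := T (2 * k) * altGeom (T (-1)) (2 * k + 1)

/-- The off-diagonal entry of the presentation matrix of the Alexander module. -/
noncomputable def offDiag (k : ℕ) : ℤ[T;T⁻¹] := -(T (2 * k + 1) * ((k : ℤ[T;T⁻¹]) * (1 - T (-1))))

theorem quot_mul (k : ℕ) : quot k * (T 1 + 1) = T ((2 * k + 1 : ℕ) : ℤ) + 1 := by
  have h := mul_altGeom (T (-1) : ℤ[T;T⁻¹]) (2 * k + 1)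
  have hp : (-T (-1) : ℤ[T;T⁻¹]) ^ (2 * k + 1) = -T (-(2 * k + 1)) := by
    rw [Odd.neg_pow ⟨k, rfl⟩, T_pow]
    congr 2
    push_cast
    ring
  have h1 : (T 1 * T (-1) : ℤ[T;T⁻¹]) = 1 := tUnit.val_inv
  have h2 : (T (2 * k) * T 1 : ℤ[T;T⁻¹]) = T ((2 * k + 1 : ℕ) : ℤ) := by
    rw [← T_add]; push_cast; rfl
  have h3 : (T ((2 * k + 1 : ℕ) : ℤ) * T (-(2 * k + 1)) : ℤ[T;T⁻¹]) = 1 := by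
    rw [← T_add, ← T_zero]; congr 1; push_cast; ring
  rw [hp] at h
  rw [quot]
  linear_combination T ((2 * k + 1 : ℕ) : ℤ) * h + h3 -
    T (2 * k) * altGeom (T (-1)) (2 * k + 1) * h1 +
    (1 + T (-1)) * altGeom (T (-1)) (2 * k + 1) * h2

/-- The two systems differ by the units `t ^ (2 k)` and `t ^ (2 k + 1)`. -/
theorem relations_iff (k : ℕ) (u v w : M) :
    altGeom (T (-1) : ℤ[T;T⁻¹]) (2 * k + 1) • (u - w) = 0 ∧
    ((T (-1) : ℤ[T;T⁻¹]) * altGeom (T (-1)) (2 * k + 1)) • (v - w) =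
      ((k : ℤ[T;T⁻¹]) * (1 - T (-1))) • (w - u) ↔
    quot k • (u - w) = 0 ∧ quot k • (v - w) = offDiag k • (u - w) := by
  have e₁ : (T (-(2 * k)) * T (2 * k) : ℤ[T;T⁻¹]) = 1 := by
    rw [← T_add, ← T_zero]; congr 1; ring
  have e₂ : (T (2 * k + 1) * T (-1) : ℤ[T;T⁻¹]) = T (2 * k) := by
    rw [← T_add]; congr 1; ring
  have e₃ : (T (-(2 * k)) * T (-1) * T (2 * k + 1) : ℤ[T;T⁻¹]) = 1 := by
    rw [← T_add, ← T_add, ← T_zero]; congr 1; ring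
  simp only [quot, offDiag]
  generalize altGeom (T (-1) : ℤ[T;T⁻¹]) (2 * k + 1) = G
  constructor
  · rintro ⟨h₁, h₂⟩
    refine ⟨by rw [mul_smul, h₁, smul_zero], ?_⟩
    rw [← e₂]
    linear_combination (norm := module) (T (2 * k + 1) : ℤ[T;T⁻¹]) • h₂
  · rintro ⟨h₁, h₂⟩
    constructor
    · rw [← one_smul ℤ[T;T⁻¹] (G • (u - w)), ← e₁, mul_smul, smul_smul (T (2 * k)), h₁, smul_zero]
    · have h₃ := congrArg (fun x => (T (-(2 * k)) * T (-1) : ℤ[T;T⁻¹]) • x) h₂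
      simp only [smul_smul] at h₃
      have h₄ : (T (-(2 * k)) * T (-1) * (T (2 * k) * G) : ℤ[T;T⁻¹]) = T (-1) * G := by
        linear_combination T (-1) * G * e₁
      have h₅ : (T (-(2 * k)) * T (-1) * -(T (2 * k + 1) * ((k : ℤ[T;T⁻¹]) * (1 - T (-1)))) :
          ℤ[T;T⁻¹]) = -((k : ℤ[T;T⁻¹]) * (1 - T (-1))) := by
        linear_combination -((k : ℤ[T;T⁻¹]) * (1 - T (-1))) * e₃
      rw [h₄, h₅] at h₃
      rw [h₃]
      module

theorem Diagram.IsColoring.map {D : Diagram} (hD : D.WellFormed) {c : ℕ → M}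
    (hc : D.IsColoring (alexanderQuandle M tUnit) c) (f : M →ₗ[ℤ[T;T⁻¹]] M₂) :
    D.IsColoring (alexanderQuandle M₂ tUnit) fun a => f (c a) := by
  rw [isColoring_iff hD] at hc ⊢
  intro ρ hρ
  simpa using congrArg f (hc ρ hρ)

/-- Constant colourings are always allowed. -/
theorem Diagram.sum_row_eq_zero {D : Diagram} (hD : D.WellFormed) (i : Fin D.rows.length) :
    ∑ j, D.alexanderMatrix i j = 0 := by
  have hc : D.IsColoring (alexanderQuandle ℤ[T;T⁻¹] tUnit) fun _ => 1 := by
    constructor <;> simp [alexanderQuandle]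
  have h := (isColoring_iff hD _).1 hc _ (List.get_mem D.rows i)
  simp only [smul_eq_mul, mul_one] at h
  exact h

variable {k m : ℕ} {D : Diagram}

theorem quot_sq_dvd
    (hD : lowerPart.run (upperPart (2 * k + 1) (connectedSum m (whiteheadDouble trefoil))) = some D)
    {x : ℤ[T;T⁻¹]} (hx : x ∈ D.alexanderIdeal) : quot k ^ 2 ∣ x := by
  have hwf := lowerPart_wellFormed.run hD
  have h3 : 3 ≤ D.arcs := (Diagram.run_mono hD).1
  let q := quot k
  let κ := offDiag k
  let P : Submodule ℤ[T;T⁻¹] (ℤ[T;T⁻¹] × ℤ[T;T⁻¹]) := Submodule.span _ {(q, 0), (-κ, q)}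
  have hrel := (relations_iff k (P.mkQ (1, 0)) (P.mkQ (0, 1)) 0).2 (by
    simp only [sub_zero, ← map_smul]
    refine ⟨?_, ?_⟩
    · rw [Submodule.mkQ_apply, Submodule.Quotient.mk_eq_zero]
      exact Submodule.subset_span (by simp [q])
    · rw [Submodule.mkQ_apply, Submodule.mkQ_apply, Submodule.Quotient.eq]
      exact Submodule.subset_span (by simp [q, κ]))
  obtain ⟨D', c, hD', -, hc, hc0, hc1, hc2⟩ := exists_isColoring_of_relations tUnit k m _ _ _
    hrel.1 hrel.2
  -- The word determines the diagram, so the colouring lives on `D`.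
  obtain rfl : D = D' := Option.some.inj (hD.symm.trans hD')
  rw [isColoring_iff hwf] at hc
  rw [← Ideal.mem_span_singleton]
  revert x
  change D.alexanderIdeal ≤ _
  rw [Diagram.alexanderIdeal, Ideal.span_le]
  rintro _ ⟨f, g, rfl⟩
  rw [SetLike.mem_coe, Ideal.mem_span_singleton]
  exact sq_dvd_minor_of_coloring h3 _ q κ (Diagram.sum_row_eq_zero hwf) c
    (fun i => hc _ (List.get_mem D.rows i)) hc0 hc1 hc2 f g

theorem quot_sq_mem
    (hD : lowerPart.run (upperPart (2 * k + 1) (connectedSum m (whiteheadDouble trefoil))) = some D) :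
    quot k ^ 2 ∈ D.alexanderIdeal := by
  have hwf := lowerPart_wellFormed.run hD
  have h3 : 3 ≤ D.arcs := (Diagram.run_mono hD).1
  let P : Submodule ℤ[T;T⁻¹] (Fin D.arcs → ℤ[T;T⁻¹]) :=
    Submodule.span _ (Set.range D.alexanderMatrix)
  -- The tautological colouring by the cokernel of the Alexander matrix; the value `0` beyond the
  -- arcs is never used.
  let c : ℕ → (Fin D.arcs → ℤ[T;T⁻¹]) ⧸ P := fun j =>
    if h : j < D.arcs then P.mkQ (Pi.single ⟨j, h⟩ 1) else 0
  have hcj : ∀ j : Fin D.arcs, c j = P.mkQ (Pi.single j 1) := fun j => dif_pos j.2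
  have hc : D.IsColoring (alexanderQuandle _ tUnit) c := by
    rw [isColoring_iff hwf]
    intro ρ hρ
    obtain ⟨i, rfl⟩ := List.get_of_mem hρ
    simp only [hcj, ← map_smul, ← map_sum]
    rw [Submodule.mkQ_apply, Submodule.Quotient.mk_eq_zero]
    have h : ∑ j, D.rows.get i j • (Pi.single j 1 : Fin D.arcs → ℤ[T;T⁻¹]) =
        D.alexanderMatrix i := by
      ext1 j
      simp [Finset.sum_apply, Pi.single_apply, Diagram.alexanderMatrix]
    rw [h]
    exact Submodule.subset_span (Set.mem_range_self i)
  obtain ⟨h₁, h₂, -⟩ := hc.relations tUnit hD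
  obtain ⟨h₁, h₂⟩ := (relations_iff k _ _ _).1 ⟨h₁, h₂⟩
  let W : Submodule ℤ[T;T⁻¹] ((Fin D.arcs → ℤ[T;T⁻¹]) ⧸ P) := Submodule.span _ {c 0, c 1, c 2}
  have hW : ∀ a < D.arcs, c a ∈ W := by
    -- Modulo `W` the three lowest minima have colour `0`, hence so have all arcs; thus `c 0`, `c
    -- 1`, `c 2` generate the cokernel.
    have h := ((hc.map hwf W.mkQ).relations tUnit hD).2.2
    simp only [Submodule.mkQ_apply, Submodule.Quotient.mk_eq_zero] at h
    exact h (Submodule.subset_span (by simp)) (Submodule.subset_span (by simp))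
      (Submodule.subset_span (by simp))
  exact sq_mem_span_minors_of_coloring h3 _ (quot k) (offDiag k) c hcj h₁ h₂ fun j => hW j j.2

end AlexanderIdeal

end KnotDiag

open LaurentPolynomial KnotDiag in
/-- For `n ≡ 3 mod 4`, the knot `J_n` is `connectedSum m (whiteheadDouble trefoil)` with
`m = (3 * n - 1) / 4`; the claim holds for every number `m` of summands. -/
theorem theorem5 (n m : ℕ) (hn : Odd n) :
    ∃ q : LaurentPolynomial ℤ, q * (T 1 + 1) = T n + 1 ∧
      IsAlexanderPolynomial (K n (connectedSum m (whiteheadDouble trefoil))) (q ^ 2) := by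
  obtain ⟨k, rfl⟩ := hn
  obtain ⟨D, hD, hs⟩ := exists_run k m
  exact ⟨quot k, quot_mul k, D, (run_K _ _).trans hD, isKnot hD hs, fun x hx => quot_sq_dvd hD hx,
    fun q hq => hq _ (quot_sq_mem hD)⟩
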